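/- **Setting.** Let $D(u,v)=\sum_{s=1}^n|u(s)-v(s)|$. Let $P_1,\dots,P_k\in\{0,1\}^n$ be templates with mixture weights $w_1,\dots,w_k$, $\sum_i w_i=1$, $w_i\ge w_{\min}>0$, and noise level $q\in(0,1/2)$. The mixture is $c$-separated: $c=\min_{i\ne j}D(P_i,P_j)/n$ (so $k\ge 2$). Examples $x_1,\dots,x_m$ are drawn independently: template $P_i$ is chosen with probability $w_i$, then each of its components is switched independently with probability $q$. $S_i$ is the set of examples coming from $P_i$, and $\mathrm{mean}(S_i)$ is their average. Put $$B=\tfrac12(1-2q)\ln\frac1{(1-q)(4q+\sqrt q)},$$ $$E=\min\left(\tfrac14,\ \frac{c(1-2q)^2/2}{c(1-2q)^2+2(1-q)(q+\sqrt q)},\ \frac{3c(1-2q)/4-2q-4\sqrt{6ql/n}}{c(1-2q)+q+\sqrt q}\right).$$ **Two-round EM.** Given templates $T_a$, weights $\omega_a$ and a noise level $q_0$, one EM step computes $f_a(x_j)=q_0^{D(x_j,T_a)}(1-q_0)^{n-D(x_j,T_a)}$, $p_a(x_j)=\omega_af_a(x_j)/\sum_b\omega_bf_b(x_j)$ (if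 the denominator vanishes, which can happen only for $q_0=0$, the quotient is its limit for $q_0\downarrow0$), the new weights $\frac1m\sum_jp_a(x_j)$ and the new templates $\sum_jp_a(x_j)x_j/\sum_jp_a(x_j)$. The algorithm is: 1. $T_1^{(0)},\dots,T_l^{(0)}$ are $l$ distinct (by index) examples chosen uniformly at random, independently of the examples, and $q_0\le\frac12$ solves $q_0(1-q_0)=\frac1{2n}\min_{a\ne b}D(T_a^{(0)},T_b^{(0)})$. 2. One EM step with $\omega_a=1/l$ gives templates $T_a^{(1)}$ and weights $w_a^{(1)}$. 3. Those with $w_a^{(1)}<\frac1{4l}$ are removed. Of the others $k$ are kept: the first one arbitrarily (e.g. at random), then repeatedly a not yet kept one whose minimum distance to the kept ones is largest. 4. One EM step from the $k$ kept templates, with weights $1/k$ and the same noise level $q_0$, gives the templates $T^{(2)}$. **Theorem.** Suppose that $l>k$, $B>0$, $0<\epsilon_0\le E$ and * C1: $nc>\frac1{B(1-2q)}\ln\frac{16l}{\min(6nq,1)}$, * C2: $m>\max(16\ln n,\,8l)$, * C3: $c>\max\left(1,\frac2{3(1-2q)}\right)\left(4q+8\sqrt{6ql/n}\right)$. Then with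 probability at least $$1-m^2e^{-2n(1-q)\epsilon_0^2/3}-m^2e^{-n\min(c,0.5)\epsilon_0^2/3}-2me^{-n\epsilon_0^2/3}-2me^{-n\min(c,0.5)\epsilon_0^2/3}-ke^{-mw_{\min}/8}-k(l+1)e^{-lw_{\min}}-ke^{-lw_{\min}/12}-\frac kn$$ the algorithm can be carried out and, whatever choices are made in step 3, the $k$ kept templates can be indexed so that for every $i=1,\dots,k$ the $i$-th one was initialized from an example in $S_i$ and $$D(T_i^{(2)},P_i)\le D(\mathrm{mean}(S_i),P_i)+\frac5{w_{\min}}e^{-ncB/4}\,nq .$$ -/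

import Mathlib

namespace TwoRoundEM

noncomputable section

/-- Binary vectors of dimension `n`, the elements of `{0,1}^n`. -/
abbrev Binary (n : ℕ) : Type := Fin n → Bool

/-- A binary vector viewed as a real vector with entries `0` and `1`. -/
def toReal {n : ℕ} (x : Binary n) : Fin n → ℝ := fun s => if x s then 1 else 0

/-- The `ℓ¹` distance `D`. -/
def D {n : ℕ} (u v : Fin n → ℝ) : ℝ := ∑ s, |u s - v s|

/-- The mixture with templates `P` is `c`-separated: `c` is the minimum over `i ≠ j` of
`D (P i) (P j) / n`. In particular there are at least two templates. -/
def IsSeparated {n k : ℕ} (P : Fin k → Binary n) (c : ℝ) : Prop :=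
  IsLeast {x : ℝ | ∃ i j : Fin k, i ≠ j ∧ x = D (toReal (P i)) (toReal (P j)) / n} c

/-! ### Constants -/

/-- The constant `B`. -/
def constB (q : ℝ) : ℝ :=
  (1 / 2) * (1 - 2 * q) * Real.log (1 / ((1 - q) * (4 * q + Real.sqrt q)))

/-- The constant `E`. -/
def constE (n l : ℕ) (q c : ℝ) : ℝ :=
  min (1 / 4) (min
    ((c * (1 - 2 * q) ^ 2 / 2) / (c * (1 - 2 * q) ^ 2 + 2 * (1 - q) * (q + Real.sqrt q)))
    ((3 * c * (1 - 2 * q) / 4 - 2 * q - 4 * Real.sqrt (6 * q * l / n)) /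
      (c * (1 - 2 * q) + q + Real.sqrt q)))

/-! ### The probability space -/

/-- All the data that the algorithm is run on: the hidden labels of the `m` examples, the `m`
examples, and the `l` distinct (indices of) examples chosen for the initialization. -/
structure Outcome (n m k l : ℕ) where
  /-- `label j` is the index of the template that generates example `j` -/
  label : Fin m → Fin k
  /-- `ex j` is the `j`-th example -/
  ex : Fin m → Binary n
  /-- `init a` is the index of the example that serves as the `a`-th initial template -/
  init : Fin l ↪ Fin m

/-- The probability that one labelled example is equal to `(i, x)`: template `i` is drawn with
probability `w i`, then every component of `P i` is switched independently with
probability `q`. -/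
def exampleWeight {n k : ℕ} (P : Fin k → Binary n) (w : Fin k → ℝ) (q : ℝ)
    (i : Fin k) (x : Binary n) : ℝ :=
  w i * ∏ s, (if x s = P i s then 1 - q else q)

/-- The probability of an outcome: the labelled examples are independent and identically
distributed, and the indices used for the initialization are, independently of the examples, a
uniformly random injection. -/
def weight {n m k l : ℕ} (P : Fin k → Binary n) (w : Fin k → ℝ) (q : ℝ)
    (ω : Outcome n m k l) : ℝ :=
  (∏ j, exampleWeight P w q (ω.label j) (ω.ex j)) * (1 / (Fintype.card (Fin l ↪ Fin m) : ℝ))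

/-- Outcomes as triples. -/
def outcomeEquiv (n m k l : ℕ) :
    ((Fin m → Fin k) × (Fin m → Binary n) × (Fin l ↪ Fin m)) ≃ Outcome n m k l where
  toFun t := ⟨t.1, t.2.1, t.2.2⟩
  invFun ω := (ω.label, ω.ex, ω.init)
  left_inv _ := rfl
  right_inv _ := rfl

instance instFintypeOutcome (n m k l : ℕ) : Fintype (Outcome n m k l) :=
  Fintype.ofEquiv _ (outcomeEquiv n m k l)

open Classical in
/-- The probability of an event. -/
def prob {n m k l : ℕ} (P : Fin k → Binary n) (w : Fin k → ℝ) (q : ℝ)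
    (A : Set (Outcome n m k l)) : ℝ :=
  ∑ ω, if ω ∈ A then weight P w q ω else 0

/-! ### One EM step -/

/-- The likelihood `q ^ D(x, t) * (1 - q) ^ (n - D(x, t))` of `x` for the (real-valued)
template `t` and the noise level `q`. -/
def likelihood {n : ℕ} (q : ℝ) (t x : Fin n → ℝ) : ℝ :=
  q ^ D x t * (1 - q) ^ ((n : ℝ) - D x t)

open Classical in
/-- E-step: the posterior probability of the `i`-th template of `T`, with prior weights `w`, given
the example `x`, namely `w i * f i / ∑ w i' * f i'` with the likelihoods `f`.

The denominator can vanish only for the noise level `q = 0`. In that case the quotient is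
read as its limit for `q` decreasing to `0`: the posterior is then carried by the templates
nearest to `x`. -/
def posterior {n r : ℕ} (w : Fin r → ℝ) (q : ℝ) (T : Fin r → Fin n → ℝ) (x : Fin n → ℝ)
    (i : Fin r) : ℝ :=
  if ∑ i', w i' * likelihood q (T i') x ≠ 0 then
    w i * likelihood q (T i) x / ∑ i', w i' * likelihood q (T i') x
  else if ∀ b, D x (T i) ≤ D x (T b) then
    w i / ∑ i', (if ∀ b, D x (T i') ≤ D x (T b) then w i' else 0)
  else 0

/-- M-step, weights: `(∑ j, p i (x j)) / m`. -/
def newWeight {n m r : ℕ} (w : Fin r → ℝ) (q : ℝ) (T : Fin r → Fin n → ℝ) (x : Fin m → Binary n)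
    (i : Fin r) : ℝ :=
  (∑ j, posterior w q T (toReal (x j)) i) / m

/-- M-step, templates: `(1 / (m * w i)) * ∑ j, p i (x j) * x j` with the new weight `w i`. -/
def newTemplate {n m r : ℕ} (w : Fin r → ℝ) (q : ℝ) (T : Fin r → Fin n → ℝ)
    (x : Fin m → Binary n) (i : Fin r) : Fin n → ℝ := fun s =>
  1 / (m * newWeight w q T x i) *
    ∑ j, posterior w q T (toReal (x j)) i * toReal (x j) s

/-! ### The two-round algorithm -/

section Algorithm

variable {n m k l : ℕ}

/-- The initial templates `T⁽⁰⁾`. -/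
def T0 (ω : Outcome n m k l) (a : Fin l) : Fin n → ℝ := toReal (ω.ex (ω.init a))

/-- The minimum over `a ≠ b` of the distances of the initial templates (for `2 ≤ l`). -/
def minInitDist (ω : Outcome n m k l) : ℝ :=
  ⨅ ab : {ab : Fin l × Fin l // ab.1 ≠ ab.2}, D (T0 ω ab.1.1) (T0 ω ab.1.2)

/-- The weights after the first round, from initial weights `1 / l` and noise level `q₀`. -/
def w1 (ω : Outcome n m k l) (q₀ : ℝ) (a : Fin l) : ℝ :=
  newWeight (fun _ => 1 / (l : ℝ)) q₀ (T0 ω) ω.ex a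

/-- The templates `T⁽¹⁾` after the first round. -/
def T1 (ω : Outcome n m k l) (q₀ : ℝ) (a : Fin l) : Fin n → ℝ :=
  newTemplate (fun _ => 1 / (l : ℝ)) q₀ (T0 ω) ω.ex a

/-- First pruning stage: template `a` survives if its weight is at least `1 / (4 l)`. -/
def Survives (ω : Outcome n m k l) (q₀ : ℝ) (a : Fin l) : Prop :=
  1 / (4 * (l : ℝ)) ≤ w1 ω q₀ a

/-- The minimum distance of template `a` from the templates selected before step `t` (for the
first step there are none, and the value is `0` for every `a`). -/
def distToSelected (ω : Outcome n m k l) (q₀ : ℝ) (s : Fin k → Fin l) (t : Fin k) (a : Fin l) : ℝ :=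
  ⨅ u : {u : Fin k // u < t}, D (T1 ω q₀ a) (T1 ω q₀ (s u.1))

/-- The numbers `q₀` and the sequence `s` of retained templates are a possible result of
initialization, first round and pruning. The first retained template is an arbitrary survivor;
each further one is, among the survivors that have not been retained yet, one of those with the
largest minimum distance from the retained ones (ties being broken arbitrarily). -/
structure IsRun (ω : Outcome n m k l) (q₀ : ℝ) (s : Fin k → Fin l) : Prop where
  noise_le : q₀ ≤ 1 / 2
  noise_eq : q₀ * (1 - q₀) = 1 / (2 * (n : ℝ)) * minInitDist ω
  survives : ∀ t, Survives ω q₀ (s t)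
  injective : Function.Injective s
  farthest : ∀ t a, Survives ω q₀ a → (∀ u, u < t → a ≠ s u) →
    distToSelected ω q₀ s t a ≤ distToSelected ω q₀ s t (s t)

/-- The templates `T⁽²⁾` after the second round, which starts from the `k` retained templates, with
weights `1 / k` and noise level `q₁ = q₀`. -/
def T2 (ω : Outcome n m k l) (q₀ : ℝ) (s : Fin k → Fin l) (t : Fin k) : Fin n → ℝ :=
  newTemplate (fun _ => 1 / (k : ℝ)) q₀ (fun u => T1 ω q₀ (s u)) ω.ex t

/-- The set `S i` of (indices of) examples coming from template `i`. -/
def S (ω : Outcome n m k l) (i : Fin k) : Finset (Fin m) :=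
  Finset.univ.filter fun j => ω.label j = i

/-- The mean of the examples in `S i`. -/
def meanS (ω : Outcome n m k l) (i : Fin k) : Fin n → ℝ := fun x =>
  (∑ j ∈ S ω i, toReal (ω.ex j) x) / ((S ω i).card : ℝ)

/-- The algorithm can be carried out, and however the choices in the pruning step are made, the
retained templates can be indexed so that the `i`-th one was initialized from an example in `S i`
and, after the second round, is as close to `P i` as `mean (S i)` up to an error `η`. -/
def Success (P : Fin k → Binary n) (η : ℝ) (ω : Outcome n m k l) : Prop :=
  (∃ q₀ s, IsRun ω q₀ s) ∧
  ∀ q₀ s, IsRun ω q₀ s → ∃ σ : Equiv.Perm (Fin k), ∀ i,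
    ω.init (s (σ i)) ∈ S ω i ∧
    D (T2 ω q₀ s (σ i)) (toReal (P i)) ≤ D (meanS ω i) (toReal (P i)) + η

end Algorithm

end

end TwoRoundEM

namespace TwoRoundEM

noncomputable section

/-! ### Distances -/

/-! The proof combines a deterministic analysis of regular samples (`success_of_good`, with
constants supplied by `success_of_regular`) with a union bound over the irregular ones
(`prob_not_success_le`).

On a regular sample each example is within `r₀`, roughly `nq`, of its own template and farther by `ζ
= n c · gap` from every other one. More than `k` initial templates lie within `nq + (5/2)√(nq)` of
their centres. Two of these share a centre, which bounds `q₀(1 - q₀)` by `q + (5/2)√(q/n)` and the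
odds `q₀/(1 - q₀)` by four times that. If an EM step starts from templates within `ρ` of their
centres and every centre is represented, a template of a wrong cluster has posterior at most `(q₀/(1
- q₀))^(ζ - 2ρ)` (`posterior_le_of_near`).

In the first round `ρ = r₀`, and the wrong posteriors are at most `q/n`. By averaging, every cluster
has a survivor (`exists_survivor`). A surviving template is a weighted mean dominated by its own
cluster, so it lies within some `r` of its centre, where `4r < nc`. Survivors are therefore at most
`2r` apart inside a cluster and more than `2r` apart across clusters, and farthest-first selection
keeps one per cluster (`IsRun.label_injective`). In the second round `ρ = r` and `ζ - 2r ≥ nc(1 -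
2q)/4`. One half of this exponent produces `exp(-ncB/4)`, the other half the factor `q`; the new
templates are then compared with the means of the clusters (`ratio_le`).

The delicate point is `r`: the weight of a survivor is only known to be at least `1/(4l)`, so it
might sit on outliers of the cluster. If `nq ≤ l`, the crude radius `r₀ + 4lq` is good enough. If
`nq ≥ l`, the total excess of all distances over `nq + √(6lnq)` is controlled (`prob_excess_le`),
which gives `r = nq + 2√(6lnq)`.

The numerical constants work because the bound is trivial unless its error terms are below 1. This
forces `n · min c 0.5 ≥ 460` and `l > 8k` (`tailExp_ge`, `eight_mul_le`, `params_of_hypotheses`). -/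

lemma D_nonneg {n : ℕ} (u v : Fin n → ℝ) : 0 ≤ D u v :=
  Finset.sum_nonneg fun _ _ => abs_nonneg _

lemma D_comm {n : ℕ} (u v : Fin n → ℝ) : D u v = D v u :=
  Finset.sum_congr rfl fun _ _ => abs_sub_comm _ _

lemma D_triangle {n : ℕ} (u v z : Fin n → ℝ) : D u z ≤ D u v + D v z := by
  unfold D
  rw [← Finset.sum_add_distrib]
  exact Finset.sum_le_sum fun _ _ => abs_sub_le _ _ _

lemma abs_toReal_sub {n : ℕ} (x y : Binary n) (s : Fin n) :
    |toReal x s - toReal y s| = if x s = y s then 0 else 1 := by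
  unfold toReal
  cases x s <;> cases y s <;> simp

lemma D_toReal {n : ℕ} (x y : Binary n) :
    D (toReal x) (toReal y) = ∑ s, if x s = y s then (0 : ℝ) else 1 :=
  Finset.sum_congr rfl fun s _ => abs_toReal_sub x y s

lemma D_toReal_le {n : ℕ} (x y : Binary n) : D (toReal x) (toReal y) ≤ n := by
  rw [D_toReal]
  calc _ ≤ ∑ _s : Fin n, (1 : ℝ) := Finset.sum_le_sum fun s _ => by split_ifs <;> norm_num
    _ = n := by simp

/-- The distance of a weighted mean of binary vectors from a binary vector is the weighted mean of
the distances. -/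
lemma D_weighted_mean {n : ℕ} {ι : Type*} (t : Finset ι) (p : ι → ℝ) (x : ι → Binary n)
    (y : Binary n) (hp : ∀ j ∈ t, 0 ≤ p j) (hW : 0 < ∑ j ∈ t, p j) :
    D (fun s => (∑ j ∈ t, p j * toReal (x j) s) / ∑ j ∈ t, p j) (toReal y)
      = (∑ j ∈ t, p j * D (toReal (x j)) (toReal y)) / ∑ j ∈ t, p j := by
  unfold D
  simp_rw [Finset.mul_sum]
  rw [Finset.sum_comm, Finset.sum_div]
  refine Finset.sum_congr rfl fun s _ => ?_
  rw [eq_div_iff hW.ne', ← abs_of_pos hW, ← abs_mul, abs_of_pos hW, sub_mul,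
    div_mul_cancel₀ _ hW.ne', Finset.mul_sum, ← Finset.sum_sub_distrib]
  -- Since `y s` is an endpoint of `[0,1]`, all differences in this component have the same sign, so
  -- the absolute value commutes with the weighted sum.
  by_cases hy : y s = true
  · have : ∀ j, |toReal (x j) s - toReal y s| = toReal y s - toReal (x j) s := by
      intro j
      unfold toReal
      rw [hy]
      cases x j s <;> simp
    rw [← abs_neg, ← Finset.sum_neg_distrib, abs_of_nonneg]
    · exact Finset.sum_congr rfl fun j _ => by rw [this]; ring
    · refine Finset.sum_nonneg fun j hj => ?_
      have h := mul_nonneg (hp j hj) (abs_nonneg (toReal (x j) s - toReal y s))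
      rw [this] at h
      linarith
  · have : ∀ j, |toReal (x j) s - toReal y s| = toReal (x j) s - toReal y s := by
      intro j
      unfold toReal
      rw [if_neg hy]
      cases x j s <;> simp
    rw [abs_of_nonneg]
    · exact Finset.sum_congr rfl fun j _ => by rw [this]; ring
    · refine Finset.sum_nonneg fun j hj => ?_
      have h := mul_nonneg (hp j hj) (abs_nonneg (toReal (x j) s - toReal y s))
      rw [this] at h
      linarith

/-! ### Posteriors -/

lemma likelihood_nonneg {n : ℕ} {q : ℝ} (h0 : 0 ≤ q) (h1 : q ≤ 1) (t x : Fin n → ℝ) :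
    0 ≤ likelihood q t x :=
  mul_nonneg (Real.rpow_nonneg h0 _) (Real.rpow_nonneg (by linarith) _)

lemma likelihood_pos {n : ℕ} {q : ℝ} (h0 : 0 < q) (h1 : q < 1) (t x : Fin n → ℝ) :
    0 < likelihood q t x :=
  mul_pos (Real.rpow_pos_of_pos h0 _) (Real.rpow_pos_of_pos (by linarith) _)

lemma likelihood_eq_mul {n : ℕ} {q : ℝ} (h0 : 0 < q) (h1 : q < 1) (t t' x : Fin n → ℝ) :
    likelihood q t' x = likelihood q t x * (q / (1 - q)) ^ (D x t' - D x t) := by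
  have h1' : 0 < 1 - q := by linarith
  unfold likelihood
  rw [Real.div_rpow h0.le h1'.le, mul_div_assoc', eq_div_iff (Real.rpow_pos_of_pos h1' _).ne']
  rw [mul_assoc, ← Real.rpow_add h1', mul_right_comm, ← Real.rpow_add h0]
  congr 2 <;> ring

lemma posterior_nonneg {n r : ℕ} {w : Fin r → ℝ} {q : ℝ} (hw : ∀ i, 0 ≤ w i) (h0 : 0 ≤ q)
    (h1 : q ≤ 1) (T : Fin r → Fin n → ℝ) (x : Fin n → ℝ) (i : Fin r) :
    0 ≤ posterior w q T x i := by
  unfold posterior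
  split_ifs
  · exact div_nonneg (mul_nonneg (hw i) (likelihood_nonneg h0 h1 _ _))
      (Finset.sum_nonneg fun b _ => mul_nonneg (hw b) (likelihood_nonneg h0 h1 _ _))
  · exact div_nonneg (hw i) (Finset.sum_nonneg fun b _ => by split_ifs <;> simp [hw])
  · exact le_rfl

lemma sum_posterior {n r : ℕ} {w : Fin r → ℝ} (hw : ∀ i, 0 < w i) (hr : 0 < r) (q : ℝ)
    (T : Fin r → Fin n → ℝ) (x : Fin n → ℝ) :
    ∑ i, posterior w q T x i = 1 := by
  classical
  unfold posterior
  by_cases h : ∑ i', w i' * likelihood q (T i') x ≠ 0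
  · simp only [if_pos h]
    rw [← Finset.sum_div, div_self h]
  · simp only [if_neg h]
    have hne : (Finset.univ : Finset (Fin r)).Nonempty := ⟨⟨0, hr⟩, Finset.mem_univ _⟩
    obtain ⟨a, -, ha⟩ := Finset.exists_min_image Finset.univ (fun b => D x (T b)) hne
    have hpos : 0 < ∑ i', (if ∀ b, D x (T i') ≤ D x (T b) then w i' else 0) := by
      refine Finset.sum_pos' (fun b _ => by split_ifs <;> simp [(hw b).le])
        ⟨a, Finset.mem_univ _, ?_⟩
      rw [if_pos fun b => ha b (Finset.mem_univ _)]
      exact hw a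
    rw [← div_self hpos.ne', Finset.sum_div]
    refine Finset.sum_congr rfl fun i _ => ?_
    split_ifs <;> simp

lemma posterior_le_one {n r : ℕ} {w : Fin r → ℝ} {q : ℝ} (hw : ∀ i, 0 < w i) (h0 : 0 ≤ q)
    (h1 : q ≤ 1) (T : Fin r → Fin n → ℝ) (x : Fin n → ℝ) (i : Fin r) :
    posterior w q T x i ≤ 1 := by
  rw [← sum_posterior hw i.pos q T x]
  exact Finset.single_le_sum (f := fun i => posterior w q T x i)
    (fun b _ => posterior_nonneg (fun i => (hw i).le) h0 h1 T x b) (Finset.mem_univ i)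

/-- A template which is farther from `x` than another one by `Δ` has a small posterior. -/
lemma posterior_le_rpow {n r : ℕ} {ω q Δ : ℝ} (hω : 0 < ω) (h0 : 0 ≤ q) (h1 : q ≤ 1 / 2)
    (hΔ : 0 < Δ) (T : Fin r → Fin n → ℝ) (x : Fin n → ℝ) (a b : Fin r)
    (h : D x (T a) + Δ ≤ D x (T b)) :
    posterior (fun _ => ω) q T x b ≤ (q / (1 - q)) ^ Δ := by
  rcases h0.eq_or_lt with rfl | h0
  -- At noise level 0 both branches of the quotient vanish: `0 ^ D = 0` for `D > 0`, and `b` is not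
  -- nearest to `x`.
  · have hb : 0 < D x (T b) := by linarith [D_nonneg x (T a)]
    have hlik : likelihood 0 (T b) x = 0 := by
      unfold likelihood
      rw [Real.zero_rpow hb.ne', zero_mul]
    have : posterior (fun _ => ω) 0 T x b = 0 := by
      unfold posterior
      split_ifs with h1 h2
      · rw [hlik]; simp
      · linarith [h2 a]
      · rfl
    rw [this]
    exact Real.rpow_nonneg (by norm_num) _
  · have hpos : 0 < ∑ i', ω * likelihood q (T i') x :=
      Finset.sum_pos (fun i _ => mul_pos hω (likelihood_pos h0 (by linarith) _ _))
        ⟨a, Finset.mem_univ _⟩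
    have hle : ω * likelihood q (T a) x ≤ ∑ i', ω * likelihood q (T i') x :=
      Finset.single_le_sum (f := fun i' => ω * likelihood q (T i') x)
        (fun i _ => (mul_pos hω (likelihood_pos h0 (by linarith) _ _)).le) (Finset.mem_univ a)
    have h1' : 0 < 1 - q := by linarith
    unfold posterior
    rw [if_pos hpos.ne', div_le_iff₀ hpos, likelihood_eq_mul h0 (by linarith) (T a) (T b) x]
    have hρ : (q / (1 - q)) ^ (D x (T b) - D x (T a)) ≤ (q / (1 - q)) ^ Δ :=
      Real.rpow_le_rpow_of_exponent_ge (div_pos h0 h1') ((div_le_one h1').2 (by linarith))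
        (by linarith)
    calc ω * (likelihood q (T a) x * (q / (1 - q)) ^ (D x (T b) - D x (T a)))
        = (q / (1 - q)) ^ (D x (T b) - D x (T a)) * (ω * likelihood q (T a) x) := by ring
      _ ≤ _ := mul_le_mul hρ hle
        (mul_nonneg hω.le (likelihood_nonneg h0.le (by linarith) _ _))
        (Real.rpow_nonneg (div_nonneg h0.le h1'.le) _)

/-! ### The M-step -/

/-- The M-step produces a posterior-weighted mean of binary vectors, so `D_weighted_mean` reduces
its distance from a centre to the distances of the single examples. -/
lemma D_newTemplate {n m r : ℕ} {w : Fin r → ℝ} {q : ℝ} (hw : ∀ i, 0 ≤ w i) (h0 : 0 ≤ q)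
    (h1 : q ≤ 1) (T : Fin r → Fin n → ℝ) (x : Fin m → Binary n) (i : Fin r)
    (hpos : 0 < ∑ j, posterior w q T (toReal (x j)) i) (y : Binary n) :
    D (newTemplate w q T x i) (toReal y)
      = (∑ j, posterior w q T (toReal (x j)) i * D (toReal (x j)) (toReal y))
        / ∑ j, posterior w q T (toReal (x j)) i := by
  have hm : (m : ℝ) ≠ 0 := by
    rintro hm
    rw [Nat.cast_eq_zero] at hm
    subst hm
    simp at hpos
  rw [← D_weighted_mean _ _ _ _ (fun j _ => posterior_nonneg hw h0 h1 _ _ _) hpos]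
  congr 1
  ext s
  unfold newTemplate newWeight
  rw [mul_div_cancel₀ _ hm, one_div, inv_mul_eq_div]

/-! ### Greedy selection -/

/-- A greedy sequence of length `k` exists in every finite set with at least `k` elements. -/
lemma exists_greedy {k : ℕ} {α : Type*} (A : Finset α) (hA : k ≤ A.card)
    (F : (Fin k → α) → Fin k → α → ℝ)
    (hF : ∀ s s' t, (∀ u, u < t → s u = s' u) → F s t = F s' t) :
    ∃ s : Fin k → α, (∀ t, s t ∈ A) ∧ Function.Injective s ∧
      ∀ t, ∀ a ∈ A, (∀ u, u < t → a ≠ s u) → F s t a ≤ F s t (s t) := by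
  classical
  have key : ∀ r ≤ k, ∃ s : Fin k → α, ∀ t : Fin k, t.val < r →
      s t ∈ A ∧ (∀ u, u < t → s t ≠ s u) ∧
      ∀ a ∈ A, (∀ u, u < t → a ≠ s u) → F s t a ≤ F s t (s t) := by
    intro r
    induction r with
    | zero =>
      intro _
      rcases Nat.eq_zero_or_pos k with rfl | hk
      · exact ⟨fun t => t.elim0, fun t => t.elim0⟩
      · obtain ⟨a, -⟩ := Finset.card_pos.1 (hk.trans_le hA)
        exact ⟨fun _ => a, fun t ht => absurd ht (Nat.not_lt_zero _)⟩
    | succ r ih =>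
      intro hr
      obtain ⟨s, hs⟩ := ih (by omega)
      let t₀ : Fin k := ⟨r, hr⟩
      let used : Finset α := (Finset.univ.filter fun u : Fin k => u < t₀).image s
      have hused : used.card < A.card := by
        calc used.card ≤ (Finset.univ.filter fun u : Fin k => u < t₀).card :=
              Finset.card_image_le
          _ < (Finset.univ : Finset (Fin k)).card := by
              refine Finset.card_lt_card (Finset.filter_ssubset.2 ⟨t₀, Finset.mem_univ _, ?_⟩)
              exact lt_irrefl _
          _ = k := Finset.card_fin k
          _ ≤ A.card := hA
      have hne : (A \ used).Nonempty := by
        obtain ⟨a, ha, ha'⟩ := Finset.exists_mem_notMem_of_card_lt_card hused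
        exact ⟨a, Finset.mem_sdiff.2 ⟨ha, ha'⟩⟩
      obtain ⟨a, ha, hmax⟩ := Finset.exists_max_image (A \ used) (F s t₀) hne
      rw [Finset.mem_sdiff] at ha
      -- The criterion at a step looks only at earlier choices, so filling entry `t₀` does not
      -- disturb the steps before it.
      have hlt : ∀ u, u < t₀ → Function.update s t₀ a u = s u := fun u hu =>
        Function.update_of_ne hu.ne _ _
      refine ⟨Function.update s t₀ a, fun t ht => ?_⟩
      rcases (Nat.lt_succ_iff.1 ht).lt_or_eq with h | h
      · have htt : t < t₀ := h
        have hu : ∀ u, u < t → Function.update s t₀ a u = s u := fun u hu =>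
          hlt u (hu.trans htt)
        rw [hF _ s t hu, hlt t htt]
        obtain ⟨h1, h2, h3⟩ := hs t h
        refine ⟨h1, fun u hut => by rw [hu u hut]; exact h2 u hut, fun b hb hbu => ?_⟩
        exact h3 b hb fun u hut => by rw [← hu u hut]; exact hbu u hut
      · have htt : t = t₀ := Fin.ext h
        rw [htt, hF _ s t₀ hlt, Function.update_self]
        refine ⟨ha.1, fun u hut => ?_, fun b hb hbu => ?_⟩
        · rw [hlt u hut]
          rintro rfl
          exact ha.2 (Finset.mem_image_of_mem _ (by simpa using hut))
        · refine hmax b (Finset.mem_sdiff.2 ⟨hb, fun hmem => ?_⟩)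
          obtain ⟨u, hu, rfl⟩ := Finset.mem_image.1 hmem
          have hut : u < t₀ := by simpa using hu
          exact hbu u hut (hlt u hut).symm
  obtain ⟨s, hs⟩ := key k le_rfl
  refine ⟨s, fun t => (hs t t.isLt).1, fun t u htu => ?_, fun t => (hs t t.isLt).2.2⟩
  by_contra hne
  rcases lt_or_gt_of_ne hne with h | h
  · exact (hs u u.isLt).2.1 t h htu.symm
  · exact (hs t t.isLt).2.1 u h htu

/-! ### Runs of the algorithm: pruning and the noise level -/

section

variable {n m k l : ℕ}

/-- One survivor per label makes at least `k` survivors, so the greedy selection never runs out of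
candidates. -/
lemma exists_isRun {ω : Outcome n m k l} {q₀ : ℝ} (h : q₀ ≤ 1 / 2)
    (h' : q₀ * (1 - q₀) = 1 / (2 * (n : ℝ)) * minInitDist ω) (lab : Fin l → Fin k)
    (hsurv : ∀ i, ∃ a, Survives ω q₀ a ∧ lab a = i) : ∃ s, IsRun ω q₀ s := by
  classical
  choose a ha ha' using hsurv
  have hinj : Function.Injective a := fun i j hij => by rw [← ha' i, ← ha' j, hij]
  have hcard : k ≤ (Finset.univ.filter fun b => Survives ω q₀ b).card := by
    calc k = (Finset.univ.image a).card := by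
          rw [Finset.card_image_of_injective _ hinj, Finset.card_fin]
      _ ≤ _ := Finset.card_le_card fun b hb => by
          obtain ⟨i, -, rfl⟩ := Finset.mem_image.1 hb
          simpa using ha i
  obtain ⟨s, h1, h2, h3⟩ := exists_greedy _ hcard (distToSelected ω q₀) (by
    intro s s' t hst
    ext b
    unfold distToSelected
    exact iInf_congr fun u => by rw [hst u.1 u.2])
  exact ⟨s, h, h', fun t => by simpa using h1 t, h2, fun t b hb hbu =>
    h3 t b (by simpa using hb) hbu⟩

/-- If surviving templates of one cluster are at distance at most `δ` and those of different
clusters at distance more than `δ`, the pruning keeps one template of each cluster. -/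
lemma IsRun.label_injective {ω : Outcome n m k l} {q₀ δ : ℝ} {s : Fin k → Fin l}
    (hrun : IsRun ω q₀ s) (lab : Fin l → Fin k)
    (hsurv : ∀ i, ∃ a, Survives ω q₀ a ∧ lab a = i)
    (hnear : ∀ a b, Survives ω q₀ a → Survives ω q₀ b → lab a = lab b →
      D (T1 ω q₀ a) (T1 ω q₀ b) ≤ δ)
    (hfar : ∀ a b, Survives ω q₀ a → Survives ω q₀ b → lab a ≠ lab b →
      δ < D (T1 ω q₀ a) (T1 ω q₀ b)) :
    Function.Injective fun t => lab (s t) := by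
  classical
  have key : ∀ u t, u < t → lab (s u) ≠ lab (s t) := by
    intro u t hut heq
    -- Fewer than `k` labels occur before step `t`. A survivor with a missing label is more than `δ`
    -- from everything kept so far, whereas `s t` is within `δ` of `s u`; choosing `s t` then
    -- contradicts `farthest`.
    have hcard : ((Finset.univ.filter fun v : Fin k => v < t).image fun v => lab (s v)).card
        < (Finset.univ : Finset (Fin k)).card :=
      Finset.card_image_le.trans_lt
        (Finset.card_lt_card (Finset.filter_ssubset.2 ⟨t, Finset.mem_univ _, lt_irrefl _⟩))
    obtain ⟨i, -, hi⟩ := Finset.exists_mem_notMem_of_card_lt_card hcard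
    obtain ⟨a, ha, rfl⟩ := hsurv i
    have hne : ∀ v, v < t → lab a ≠ lab (s v) := fun v hv h =>
      hi (Finset.mem_image.2 ⟨v, by simpa using hv, h.symm⟩)
    have h1 := hrun.farthest t a ha fun v hv h => hne v hv (by rw [h])
    have : Nonempty {v : Fin k // v < t} := ⟨⟨u, hut⟩⟩
    obtain ⟨v, hv⟩ := exists_eq_ciInf_of_finite
      (f := fun v : {v : Fin k // v < t} => D (T1 ω q₀ a) (T1 ω q₀ (s v.1)))
    have h2 : distToSelected ω q₀ s t (s t) ≤ D (T1 ω q₀ (s t)) (T1 ω q₀ (s u)) :=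
      ciInf_le (Set.finite_range _).bddBelow (⟨u, hut⟩ : {v : Fin k // v < t})
    have h3 := hnear (s t) (s u) (hrun.survives t) (hrun.survives u) heq.symm
    have h4 := hfar a (s v.1) ha (hrun.survives _) (hne v.1 v.2)
    have h5 : distToSelected ω q₀ s t a = D (T1 ω q₀ a) (T1 ω q₀ (s v.1)) := hv.symm
    linarith
  intro u t hut
  by_contra hne
  rcases lt_or_gt_of_ne hne with h | h
  · exact key u t h hut
  · exact key t u h hut.symm

lemma minInitDist_nonneg (ω : Outcome n m k l) : 0 ≤ minInitDist ω :=
  Real.iInf_nonneg fun _ => D_nonneg _ _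

lemma minInitDist_le (ω : Outcome n m k l) {a b : Fin l} (hab : a ≠ b) :
    minInitDist ω ≤ D (T0 ω a) (T0 ω b) :=
  ciInf_le (f := fun ab : {ab : Fin l × Fin l // ab.1 ≠ ab.2} => D (T0 ω ab.1.1) (T0 ω ab.1.2))
    (Set.finite_range _).bddBelow ⟨(a, b), hab⟩

lemma exists_noise {v : ℝ} (hv : v ≤ 1 / 4) : ∃ q₀ : ℝ, q₀ ≤ 1 / 2 ∧ q₀ * (1 - q₀) = v := by
  refine ⟨(1 - Real.sqrt (1 - 4 * v)) / 2, ?_, ?_⟩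
  · linarith [Real.sqrt_nonneg (1 - 4 * v)]
  · nlinarith [Real.sq_sqrt (show 0 ≤ 1 - 4 * v by linarith)]

lemma IsRun.noise_nonneg {ω : Outcome n m k l} {q₀ : ℝ} {s : Fin k → Fin l}
    (hrun : IsRun ω q₀ s) : 0 ≤ q₀ := by
  by_contra h
  have h1 := hrun.noise_eq
  have h2 : 0 ≤ 1 / (2 * (n : ℝ)) * minInitDist ω :=
    mul_nonneg (by positivity) (minInitDist_nonneg ω)
  nlinarith

end

/-! ### The algorithm on well-behaved data -/

/-- For `x ≤ 1/2` one has `1/(1 - x) ≤ 1 + 2x`. In the application `N` is the size of a cluster,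
`A₀` the sum of its distances from the centre, `x` the share of posterior mass it may lose, and `b`
the contribution of foreign examples. -/
lemma ratio_le {A A₀ W N x d b : ℝ} (hN : 0 < N) (hx : 0 ≤ x) (hx' : x ≤ 1 / 2)
    (hW : N * (1 - x) ≤ W) (hA : A ≤ A₀ + b) (hA₀ : 0 ≤ A₀) (hA₀' : A₀ ≤ N * d)
    (hb : 0 ≤ b) : A / W ≤ A₀ / N + 2 * x * d + 2 * (b / N) := by
  have h1 : 0 < N * (1 - x) := mul_pos hN (by linarith)
  have h2 : (A₀ + b) / (N * (1 - x)) ≤ A₀ / N + 2 * x * d + 2 * (b / N) := by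
    rw [div_le_iff₀ h1]
    have e : (A₀ / N + 2 * x * d + 2 * (b / N)) * (N * (1 - x))
        = (A₀ + 2 * x * (N * d) + 2 * b) * (1 - x) := by field_simp
    rw [e]
    have h3 : A₀ ≤ (A₀ + 2 * x * (N * d)) * (1 - x) := by
      have : x * A₀ ≤ x * (N * d) := mul_le_mul_of_nonneg_left hA₀' hx
      nlinarith [mul_nonneg hx hA₀, mul_nonneg hx (hA₀.trans hA₀')]
    nlinarith
  calc A / W ≤ (A₀ + b) / W := by
        gcongr
        exact h1.le.trans hW
    _ ≤ (A₀ + b) / (N * (1 - x)) := by gcongr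
    _ ≤ _ := h2

section

variable {n m k l : ℕ}

/-- If all templates are near their centers, the posterior of a template is small on examples that
come from another center. -/
lemma posterior_le_of_near {r : ℕ} {ω : Outcome n m k l} {P : Fin k → Binary n}
    {ζ r₀ q₀ c₀ : ℝ} (hc₀ : 0 < c₀) (hq : 0 ≤ q₀) (hq' : q₀ ≤ 1 / 2)
    (hsep : ∀ j i, i ≠ ω.label j → D (toReal (ω.ex j)) (toReal (P (ω.label j))) + ζ ≤
      D (toReal (ω.ex j)) (toReal (P i)))
    (T : Fin r → Fin n → ℝ) (lab : Fin r → Fin k) (hlab : Function.Surjective lab)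
    (hT : ∀ a, D (T a) (toReal (P (lab a))) ≤ r₀) (hζ : 0 < ζ - 2 * r₀) (j : Fin m) (b : Fin r)
    (hb : lab b ≠ ω.label j) :
    posterior (fun _ => c₀) q₀ T (toReal (ω.ex j)) b ≤ (q₀ / (1 - q₀)) ^ (ζ - 2 * r₀) := by
  obtain ⟨a, ha⟩ := hlab (ω.label j)
  refine posterior_le_rpow hc₀ hq hq' hζ T _ a b ?_
  -- Replacing the two centres by the templates near them costs `r₀` each.
  have h1 := D_triangle (toReal (ω.ex j)) (toReal (P (lab a))) (T a)
  have h2 := D_triangle (toReal (ω.ex j)) (T b) (toReal (P (lab b)))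
  have h3 := hsep j _ hb
  have h4 := hT a
  have h5 := hT b
  rw [D_comm] at h4
  rw [ha] at h1 h4
  linarith

/-- Averaging: the templates of cluster `i` together take at least `3/4` of each example in `S i`,
in total at least `(3/8) m w i`. There are at most `(3/2) l w i` of them, so they cannot all stay
below `m/(4l)`. -/
lemma exists_survivor {ω : Outcome n m k l} {q₀ lam : ℝ} {w : Fin k → ℝ} (hq : 0 ≤ q₀)
    (hq' : q₀ ≤ 1 / 2) (hm : 0 < m) (hl : 0 < l)
    (hS : ∀ i, m * w i / 2 ≤ (S ω i).card)
    (hC : ∀ i, ((Finset.univ.filter fun a => ω.label (ω.init a) = i).card : ℝ) ≤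
      3 / 2 * l * w i)
    (hC' : ∀ i, ∃ a, ω.label (ω.init a) = i)
    (hp : ∀ j a, ω.label (ω.init a) ≠ ω.label j →
      posterior (fun _ => 1 / (l : ℝ)) q₀ (T0 ω) (toReal (ω.ex j)) a ≤ lam)
    (hlam : l * lam ≤ 1 / 4) (hlam' : 0 ≤ lam) (i : Fin k) :
    ∃ a, Survives ω q₀ a ∧ ω.label (ω.init a) = i := by
  classical
  by_contra! hcon
  set p : Fin m → Fin l → ℝ := fun j a =>
    posterior (fun _ => 1 / (l : ℝ)) q₀ (T0 ω) (toReal (ω.ex j)) a with hpdef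
  have hl' : (0 : ℝ) < l := by exact_mod_cast hl
  have hm' : (0 : ℝ) < m := by exact_mod_cast hm
  have hpos : ∀ _ : Fin l, 0 < 1 / (l : ℝ) := fun _ => by positivity
  have hp0 : ∀ j a, 0 ≤ p j a := fun j a =>
    posterior_nonneg (fun i => (hpos i).le) hq (by linarith) _ _ _
  set C := Finset.univ.filter fun a => ω.label (ω.init a) = i with hCdef
  have hlow : ∀ j ∈ S ω i, 3 / 4 ≤ ∑ a ∈ C, p j a := by
    intro j hj
    have hj' : ω.label j = i := by simpa [S] using hj
    have h1 : ∑ a, p j a = 1 := sum_posterior hpos hl _ _ _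
    rw [← Finset.sum_filter_add_sum_filter_not _ (fun a => ω.label (ω.init a) = i)] at h1
    have h2 : ∑ a with ¬ ω.label (ω.init a) = i, p j a ≤ l * lam := by
      calc ∑ a with ¬ ω.label (ω.init a) = i, p j a
          ≤ ∑ a with ¬ ω.label (ω.init a) = i, lam :=
            Finset.sum_le_sum fun a ha => hp j a (by
              rw [hj']; exact (Finset.mem_filter.1 ha).2)
        _ ≤ ∑ _a : Fin l, lam :=
            Finset.sum_le_sum_of_subset_of_nonneg (Finset.filter_subset _ _)
              fun _ _ _ => hlam'
        _ = l * lam := by simp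
    linarith
  have h1 : 3 / 4 * ((S ω i).card : ℝ) ≤ ∑ a ∈ C, ∑ j, p j a := by
    rw [Finset.sum_comm]
    calc 3 / 4 * ((S ω i).card : ℝ) = ∑ _j ∈ S ω i, (3 / 4 : ℝ) := by simp [mul_comm]
      _ ≤ ∑ j ∈ S ω i, ∑ a ∈ C, p j a := Finset.sum_le_sum hlow
      _ ≤ ∑ j, ∑ a ∈ C, p j a :=
          Finset.sum_le_sum_of_subset_of_nonneg (Finset.subset_univ _)
            fun j _ _ => Finset.sum_nonneg fun a _ => hp0 j a
  have h2 : ∑ a ∈ C, ∑ j, p j a < ∑ _a ∈ C, (m : ℝ) / (4 * l) := by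
    obtain ⟨a₀, ha₀⟩ := hC' i
    refine Finset.sum_lt_sum_of_nonempty ⟨a₀, by simp [hCdef, ha₀]⟩ fun a ha => ?_
    have h3 : ¬ Survives ω q₀ a := fun h => hcon a h (by simpa [hCdef] using ha)
    unfold Survives w1 newWeight at h3
    rw [not_le, div_lt_iff₀ hm'] at h3
    calc ∑ j, p j a < 1 / (4 * l) * m := h3
      _ = m / (4 * l) := by ring
  rw [Finset.sum_const, nsmul_eq_mul] at h2
  have h3 : (C.card : ℝ) * (m / (4 * l)) ≤ 3 / 2 * l * w i * (m / (4 * l)) := by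
    gcongr
    exact hC i
  have h4 : 3 / 2 * l * w i * ((m : ℝ) / (4 * l)) = 3 / 8 * (m * w i) := by
    field_simp
    ring
  have h5 := hS i
  linarith

/-- Deterministic analysis of the algorithm on data with well-separated examples. -/
theorem success_of_good {ω : Outcome n m k l} {P : Fin k → Binary n} {w : Fin k → ℝ}
    {wmin V r₀ r ζ δ lam₁ lam₂ η : ℝ} (hm : 0 < m) (hl : 0 < l) (hk : 0 < k)
    (hwmin : 0 < wmin) (hw : ∀ i, wmin ≤ w i) (hkw : k * wmin ≤ 1)
    (hS : ∀ i, m * w i / 2 ≤ (S ω i).card)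
    (hC : ∀ i, ((Finset.univ.filter fun a => ω.label (ω.init a) = i).card : ℝ) ≤
      3 / 2 * l * w i)
    (hC' : ∀ i, ∃ a, ω.label (ω.init a) = i)
    (hV : 1 / (2 * (n : ℝ)) * minInitDist ω ≤ V) (hV' : V ≤ 1 / 4)
    (hnear : ∀ j, D (toReal (ω.ex j)) (toReal (P (ω.label j))) ≤ r₀)
    (hsep : ∀ j i, i ≠ ω.label j → D (toReal (ω.ex j)) (toReal (P (ω.label j))) + ζ ≤
      D (toReal (ω.ex j)) (toReal (P i)))
    (hP : ∀ i i', i ≠ i' → δ ≤ D (toReal (P i)) (toReal (P i')))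
    (hmean : ∀ i (p : Fin m → ℝ), (∀ j, 0 ≤ p j) → (∀ j, p j ≤ 1) →
      (∀ j, ω.label j ≠ i → p j ≤ lam₁) → m / (4 * (l : ℝ)) ≤ ∑ j, p j →
      ∑ j, p j * D (toReal (ω.ex j)) (toReal (P i)) ≤ r * ∑ j, p j)
    (hδ : 4 * r < δ) (hζ₀ : 0 < ζ - 2 * r₀) (hζ : 0 < ζ - 2 * r)
    (hlam₁ : ∀ q₀ : ℝ, 0 ≤ q₀ → q₀ ≤ 1 / 2 → q₀ * (1 - q₀) ≤ V →
      (q₀ / (1 - q₀)) ^ (ζ - 2 * r₀) ≤ lam₁)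
    (hlam₂ : ∀ q₀ : ℝ, 0 ≤ q₀ → q₀ ≤ 1 / 2 → q₀ * (1 - q₀) ≤ V →
      (q₀ / (1 - q₀)) ^ (ζ - 2 * r) ≤ lam₂)
    (hll : l * lam₁ ≤ 1 / 4) (hl0 : 0 ≤ lam₁) (hl0' : 0 ≤ lam₂) (hkl : k * lam₂ ≤ 1 / 2)
    (hη : 6 / wmin * lam₂ * n ≤ η) : Success P η ω := by
  classical
  have hl' : (0 : ℝ) < l := by exact_mod_cast hl
  have hm' : (0 : ℝ) < m := by exact_mod_cast hm
  have hk' : (0 : ℝ) < k := by exact_mod_cast hk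
  have hw0 : ∀ i, 0 < w i := fun i => hwmin.trans_le (hw i)
  have hlpos : ∀ _ : Fin l, 0 < 1 / (l : ℝ) := fun _ => by positivity
  have hkpos : ∀ _ : Fin k, 0 < 1 / (k : ℝ) := fun _ => by positivity
  have hpost₁ : ∀ q₀ : ℝ, 0 ≤ q₀ → q₀ ≤ 1 / 2 → q₀ * (1 - q₀) ≤ V →
      ∀ j a, ω.label (ω.init a) ≠ ω.label j →
      posterior (fun _ => 1 / (l : ℝ)) q₀ (T0 ω) (toReal (ω.ex j)) a ≤ lam₁ := by
    intro q₀ h1 h2 h3 j a ha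
    exact (posterior_le_of_near (by positivity) h1 h2 hsep (T0 ω)
      (fun a => ω.label (ω.init a)) hC' (fun a => hnear (ω.init a)) hζ₀ j a ha).trans
      (hlam₁ q₀ h1 h2 h3)
  have hsurv : ∀ q₀ : ℝ, 0 ≤ q₀ → q₀ ≤ 1 / 2 → q₀ * (1 - q₀) ≤ V →
      ∀ i, ∃ a, Survives ω q₀ a ∧ ω.label (ω.init a) = i := fun q₀ h1 h2 h3 =>
    exists_survivor h1 h2 hm hl hS hC hC' (hpost₁ q₀ h1 h2 h3) hll hl0
  have hnear₁ : ∀ q₀ : ℝ, 0 ≤ q₀ → q₀ ≤ 1 / 2 → q₀ * (1 - q₀) ≤ V →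
      ∀ a, Survives ω q₀ a → D (T1 ω q₀ a) (toReal (P (ω.label (ω.init a)))) ≤ r := by
    intro q₀ h1 h2 h3 a ha
    have hW : m / (4 * (l : ℝ)) ≤
        ∑ j, posterior (fun _ => 1 / (l : ℝ)) q₀ (T0 ω) (toReal (ω.ex j)) a := by
      unfold Survives w1 newWeight at ha
      rw [le_div_iff₀ hm'] at ha
      calc m / (4 * (l : ℝ)) = 1 / (4 * l) * m := by ring
        _ ≤ _ := ha
    have hW0 : 0 < ∑ j, posterior (fun _ => 1 / (l : ℝ)) q₀ (T0 ω) (toReal (ω.ex j)) a :=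
      lt_of_lt_of_le (by positivity) hW
    unfold T1
    rw [D_newTemplate (fun i => (hlpos i).le) h1 (by linarith) _ _ _ hW0, div_le_iff₀ hW0]
    exact hmean _ _ (fun j => posterior_nonneg (fun i => (hlpos i).le) h1 (by linarith) _ _ _)
      (fun j => posterior_le_one hlpos h1 (by linarith) _ _ _)
      (fun j hj => hpost₁ q₀ h1 h2 h3 j a (Ne.symm hj)) hW
  constructor
  · obtain ⟨q₀, hq', hq⟩ := exists_noise (hV.trans hV')
    have hq0 : 0 ≤ q₀ := by
      by_contra h
      have h2 : 0 ≤ 1 / (2 * (n : ℝ)) * minInitDist ω :=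
        mul_nonneg (by positivity) (minInitDist_nonneg ω)
      nlinarith
    obtain ⟨s, hs⟩ := exists_isRun hq' hq (fun a => ω.label (ω.init a))
      (hsurv q₀ hq0 hq' (hq.trans_le hV))
    exact ⟨q₀, s, hs⟩
  · intro q₀ s hrun
    have h1 := hrun.noise_nonneg
    have h2 := hrun.noise_le
    have h3 := hrun.noise_eq.trans_le hV
    have hne := hnear₁ q₀ h1 h2 h3
    -- The threshold `2r` separates the two kinds of pairs: across clusters the distance is at least
    -- `δ - 2r`, and `4r < δ`.
    have hinj := hrun.label_injective (δ := 2 * r) (fun a => ω.label (ω.init a))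
      (hsurv q₀ h1 h2 h3) (by
        intro a b ha hb hab
        have e1 := hne a ha
        have e2 := hne b hb
        rw [D_comm, ← hab] at e2
        linarith [D_triangle (T1 ω q₀ a) (toReal (P (ω.label (ω.init a)))) (T1 ω q₀ b)]) (by
        intro a b ha hb hab
        have e1 := hne a ha
        have e2 := hne b hb
        rw [D_comm] at e1
        linarith [hP _ _ hab, D_triangle (toReal (P (ω.label (ω.init a)))) (T1 ω q₀ a)
          (toReal (P (ω.label (ω.init b)))),
          D_triangle (T1 ω q₀ a) (T1 ω q₀ b) (toReal (P (ω.label (ω.init b))))])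
    have hbij := Finite.injective_iff_bijective.1 hinj
    let e : Equiv.Perm (Fin k) := Equiv.ofBijective _ hbij
    have he : ∀ i, ω.label (ω.init (s (e.symm i))) = i := fun i => e.apply_symm_apply i
    refine ⟨e.symm, fun i => ⟨by simp [S, he], ?_⟩⟩
    have hpost₂ : ∀ j t, ω.label (ω.init (s t)) ≠ ω.label j →
        posterior (fun _ => 1 / (k : ℝ)) q₀ (fun u => T1 ω q₀ (s u)) (toReal (ω.ex j)) t
          ≤ lam₂ := fun j t ht =>
      (posterior_le_of_near (by positivity) h1 h2 hsep _
        (fun t => ω.label (ω.init (s t))) hbij.2 (fun t => hne _ (hrun.survives t)) hζ j t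
        ht).trans (hlam₂ q₀ h1 h2 h3)
    set p : Fin m → Fin k → ℝ := fun j t =>
      posterior (fun _ => 1 / (k : ℝ)) q₀ (fun u => T1 ω q₀ (s u)) (toReal (ω.ex j)) t with hp
    have hp0 : ∀ j t, 0 ≤ p j t := fun j t =>
      posterior_nonneg (fun i => (hkpos i).le) h1 (by linarith) _ _ _
    have hp1 : ∀ j t, p j t ≤ 1 := fun j t =>
      posterior_le_one hkpos h1 (by linarith) _ _ _
    set t := e.symm i with ht
    have hlow : ∀ j ∈ S ω i, 1 - k * lam₂ ≤ p j t := by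
      intro j hj
      have hj' : ω.label j = i := by simpa [S] using hj
      have e1 : ∑ u, p j u = 1 := sum_posterior hkpos hk _ _ _
      rw [← Finset.add_sum_erase _ _ (Finset.mem_univ t)] at e1
      have e2 : ∑ u ∈ Finset.univ.erase t, p j u ≤ k * lam₂ := by
        calc ∑ u ∈ Finset.univ.erase t, p j u ≤ ∑ u ∈ Finset.univ.erase t, lam₂ := by
              refine Finset.sum_le_sum fun u hu => hpost₂ j u fun hlab => ?_
              refine (Finset.mem_erase.1 hu).1 (hinj ?_)
              simp only [hlab, hj', ht, he]
          _ ≤ ∑ _u : Fin k, lam₂ :=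
              Finset.sum_le_sum_of_subset_of_nonneg (Finset.erase_subset _ _)
                fun _ _ _ => hl0'
          _ = k * lam₂ := by simp
      linarith
    have hNw : (0 : ℝ) < m * w i / 2 := by
      have := hw0 i
      positivity
    have hN : (0 : ℝ) < (S ω i).card := hNw.trans_le (hS i)
    have hWlow : ((S ω i).card : ℝ) * (1 - k * lam₂) ≤ ∑ j, p j t := by
      calc ((S ω i).card : ℝ) * (1 - k * lam₂) = ∑ _j ∈ S ω i, (1 - k * lam₂) := by
            rw [Finset.sum_const, nsmul_eq_mul]
        _ ≤ ∑ j ∈ S ω i, p j t := Finset.sum_le_sum hlow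
        _ ≤ ∑ j, p j t := Finset.sum_le_sum_of_subset_of_nonneg (Finset.subset_univ _)
            fun j _ _ => hp0 j t
    have hWpos : 0 < ∑ j, p j t := lt_of_lt_of_le (mul_pos hN (by linarith)) hWlow
    have hD0 : ∀ j, 0 ≤ D (toReal (ω.ex j)) (toReal (P i)) := fun j => D_nonneg _ _
    -- An example of the cluster counts at most fully, a foreign one at most `lam₂ * n`.
    have hA : ∑ j, p j t * D (toReal (ω.ex j)) (toReal (P i)) ≤
        ∑ j ∈ S ω i, D (toReal (ω.ex j)) (toReal (P i)) + m * (lam₂ * n) := by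
      rw [← Finset.sum_filter_add_sum_filter_not _ (fun j => ω.label j = i)]
      refine add_le_add (Finset.sum_le_sum fun j _ => ?_) ?_
      · exact mul_le_of_le_one_left (hD0 j) (hp1 j t)
      · calc ∑ j with ¬ ω.label j = i, p j t * D (toReal (ω.ex j)) (toReal (P i))
            ≤ ∑ j with ¬ ω.label j = i, lam₂ * n := by
              refine Finset.sum_le_sum fun j hj => ?_
              refine mul_le_mul (hpost₂ j t ?_) (D_toReal_le _ _) (hD0 j) hl0'
              rw [ht, he]
              exact fun h => (Finset.mem_filter.1 hj).2 h.symm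
          _ ≤ ∑ _j : Fin m, lam₂ * n :=
              Finset.sum_le_sum_of_subset_of_nonneg (Finset.filter_subset _ _)
                fun _ _ _ => by positivity
          _ = m * (lam₂ * n) := by simp
    have hmS : D (meanS ω i) (toReal (P i)) =
        (∑ j ∈ S ω i, D (toReal (ω.ex j)) (toReal (P i))) / (S ω i).card := by
      have := D_weighted_mean (S ω i) (fun _ => (1 : ℝ)) ω.ex (P i) (fun _ _ => zero_le_one)
        (by simpa using hN)
      simp only [one_mul, Finset.sum_const, nsmul_eq_mul, mul_one] at this
      exact this
    unfold T2
    rw [D_newTemplate (fun i => (hkpos i).le) h1 (by linarith) _ _ _ hWpos, hmS]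
    have hfin := ratio_le (d := n) hN (by positivity) hkl hWlow hA
      (Finset.sum_nonneg fun j _ => hD0 j) (by
        calc ∑ j ∈ S ω i, D (toReal (ω.ex j)) (toReal (P i)) ≤ ∑ _j ∈ S ω i, (n : ℝ) :=
              Finset.sum_le_sum fun j _ => D_toReal_le _ _
          _ = _ := by simp) (by positivity)
    refine hfin.trans ?_
    -- The constant 6 is 2 + 4: 2 from the lost mass `k * lam₂`, with `k ≤ 1/wmin`, and 4 from the
    -- foreign examples, with `m / |S i| ≤ 2/wmin`.
    have hk1 : (k : ℝ) ≤ 1 / wmin := by rwa [le_div_iff₀ hwmin]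
    have hmN : (m : ℝ) / (S ω i).card ≤ 2 / wmin := by
      rw [div_le_div_iff₀ hN hwmin]
      have := hS i
      have := mul_le_mul_of_nonneg_left (hw i) hm'.le
      linarith
    have e1 : 2 * (k * lam₂) * (n : ℝ) ≤ 2 * (1 / wmin * lam₂) * n := by gcongr
    have e2 : 2 * ((m : ℝ) * (lam₂ * n) / (S ω i).card) ≤ 2 * (2 / wmin * (lam₂ * n)) := by
      rw [mul_div_right_comm]
      gcongr
    have e3 : 2 * (1 / wmin * lam₂) * n + 2 * (2 / wmin * (lam₂ * n)) = 6 / wmin * lam₂ * n := by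
      ring
    linarith

end

/-! ### Expectations -/

/-- Expectation over the noisy copies of a template. -/
def flipMean {n : ℕ} (q : ℝ) (p : Binary n) (f : Binary n → ℝ) : ℝ :=
  ∑ x : Binary n, (∏ s, (if x s = p s then 1 - q else q)) * f x

/-- Expectation over one labelled example. -/
def exMean {n k : ℕ} (P : Fin k → Binary n) (w : Fin k → ℝ) (q : ℝ)
    (f : Fin k → Binary n → ℝ) : ℝ :=
  ∑ i, w i * flipMean q (P i) (f i)

/-- The number of components in `T` in which `x` differs from `p`. -/
def flips {n : ℕ} (p : Binary n) (T : Finset (Fin n)) (x : Binary n) : ℝ :=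
  ∑ s ∈ T, if x s = p s then 0 else 1

lemma flipMean_mono {n : ℕ} {q : ℝ} (h0 : 0 ≤ q) (h1 : q ≤ 1) (p : Binary n)
    {f g : Binary n → ℝ} (h : ∀ x, f x ≤ g x) : flipMean q p f ≤ flipMean q p g :=
  Finset.sum_le_sum fun x _ => mul_le_mul_of_nonneg_left (h x)
    (Finset.prod_nonneg fun s _ => by split_ifs <;> linarith)

lemma flipMean_const_mul {n : ℕ} (q : ℝ) (p : Binary n) (a : ℝ) (f : Binary n → ℝ) :
    flipMean q p (fun x => a * f x) = a * flipMean q p f := by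
  unfold flipMean
  rw [Finset.mul_sum]
  exact Finset.sum_congr rfl fun x _ => by ring

lemma flipMean_add {n : ℕ} (q : ℝ) (p : Binary n) (f g : Binary n → ℝ) :
    flipMean q p (fun x => f x + g x) = flipMean q p f + flipMean q p g := by
  unfold flipMean
  rw [← Finset.sum_add_distrib]
  exact Finset.sum_congr rfl fun x _ => by ring

lemma flipMean_sum {n : ℕ} (q : ℝ) (p : Binary n) {ι : Type*} (t : Finset ι)
    (f : ι → Binary n → ℝ) :
    flipMean q p (fun x => ∑ i ∈ t, f i x) = ∑ i ∈ t, flipMean q p (f i) := by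
  unfold flipMean
  rw [Finset.sum_comm]
  exact Finset.sum_congr rfl fun x _ => by rw [Finset.mul_sum]

/-- Components are switched independently, so expectations of products factor. The moment generating
function and the variance of the number of flips both come from this. -/
lemma flipMean_prod {n : ℕ} (q : ℝ) (p : Binary n) (g : Fin n → Bool → ℝ) :
    flipMean q p (fun x => ∏ s, g s (x s))
      = ∏ s, ((1 - q) * g s (p s) + q * g s (!p s)) := by
  unfold flipMean
  simp_rw [← Finset.prod_mul_distrib]
  rw [← Fintype.piFinset_univ, ← Finset.prod_univ_sum (fun _ => Finset.univ)
    (fun s b => (if b = p s then 1 - q else q) * g s b)]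
  refine Finset.prod_congr rfl fun s _ => ?_
  rw [Fintype.sum_bool]
  cases p s <;> simp [add_comm]

lemma flipMean_one {n : ℕ} (q : ℝ) (p : Binary n) : flipMean q p (fun _ => 1) = 1 := by
  have := flipMean_prod q p (fun _ _ => 1)
  simpa using this

lemma flipMean_const {n : ℕ} (q : ℝ) (p : Binary n) (a : ℝ) :
    flipMean q p (fun _ => a) = a := by
  have := flipMean_const_mul q p a (fun _ => 1)
  rw [flipMean_one] at this
  simpa using this

lemma flipMean_exp_flips {n : ℕ} (q η : ℝ) (p : Binary n) (T : Finset (Fin n)) :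
    flipMean q p (fun x => Real.exp (η * flips p T x))
      = (1 + q * (Real.exp η - 1)) ^ T.card := by
  have h := flipMean_prod q p (fun s b => if s ∈ T then (if b = p s then 1 else Real.exp η) else 1)
  have e : ∀ x, Real.exp (η * flips p T x)
      = ∏ s, (if s ∈ T then (if x s = p s then 1 else Real.exp η) else 1) := by
    intro x
    unfold flips
    rw [Finset.mul_sum, Real.exp_sum, Finset.prod_ite_mem, Finset.univ_inter]
    refine Finset.prod_congr rfl fun s _ => ?_
    split_ifs <;> simp
  simp_rw [e]
  rw [h, ← Finset.prod_const, ← Finset.univ_inter T, ← Finset.prod_ite_mem]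
  refine Finset.prod_congr rfl fun s _ => ?_
  simp only [Finset.univ_inter]
  split_ifs <;> simp_all
  ring

lemma flipMean_exp_flips_le {n : ℕ} {q η : ℝ} (h0 : 0 ≤ q) (hη : 0 ≤ η) (p : Binary n)
    (T : Finset (Fin n)) :
    flipMean q p (fun x => Real.exp (η * flips p T x))
      ≤ Real.exp (T.card * q * (Real.exp η - 1)) := by
  rw [flipMean_exp_flips]
  have h1 : 0 ≤ q * (Real.exp η - 1) := mul_nonneg h0 (by linarith [Real.one_le_exp hη])
  have h2 : 1 + q * (Real.exp η - 1) ≤ Real.exp (q * (Real.exp η - 1)) := by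
    linarith [Real.add_one_le_exp (q * (Real.exp η - 1))]
  calc (1 + q * (Real.exp η - 1)) ^ T.card
      ≤ Real.exp (q * (Real.exp η - 1)) ^ T.card := by gcongr
    _ = _ := by rw [← Real.exp_nat_mul]; ring_nf

lemma D_eq_flips {n : ℕ} (x p : Binary n) :
    D (toReal x) (toReal p) = flips p Finset.univ x := D_toReal x p

/-- The variance of the number of flipped components. -/
lemma flipMean_sq_le {n : ℕ} {q : ℝ} (h0 : 0 ≤ q) (p : Binary n) :
    flipMean q p (fun x => (flips p Finset.univ x - n * q) ^ 2) ≤ n * q := by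
  have key : ∀ s s' : Fin n, flipMean q p (fun x =>
      ((if x s = p s then 0 else 1) - q) * ((if x s' = p s' then 0 else 1) - q))
        = if s = s' then q * (1 - q) else 0 := by
    intro s s'
    have h := flipMean_prod q p (fun r b =>
      (if r = s then (if b = p r then 0 else 1) - q else 1) *
        (if r = s' then (if b = p r then 0 else 1) - q else 1))
    have e : ∀ x : Binary n, ((if x s = p s then (0 : ℝ) else 1) - q) *
        ((if x s' = p s' then 0 else 1) - q) = ∏ r, ((if r = s then
          (if x r = p r then 0 else 1) - q else 1) *
        (if r = s' then (if x r = p r then 0 else 1) - q else 1)) := by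
      intro x
      rw [Finset.prod_mul_distrib, Finset.prod_ite_eq', Finset.prod_ite_eq']
      simp
    simp_rw [e]
    rw [h]
    split_ifs with hs
    · subst hs
      rw [Finset.prod_eq_single s (fun r _ hr => by simp [hr]) (by simp)]
      simp
      ring
    · refine Finset.prod_eq_zero (Finset.mem_univ s) ?_
      simp [hs]
      ring
  have e : ∀ x : Binary n, (flips p Finset.univ x - n * q) ^ 2 = ∑ s, ∑ s',
      ((if x s = p s then (0 : ℝ) else 1) - q) * ((if x s' = p s' then 0 else 1) - q) := by
    intro x
    rw [← Finset.sum_mul_sum, ← sq]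
    unfold flips
    rw [Finset.sum_sub_distrib]
    simp
  simp_rw [e]
  rw [flipMean_sum]
  simp_rw [flipMean_sum, key]
  simp
  nlinarith [mul_nonneg (Nat.cast_nonneg (α := ℝ) n) (mul_nonneg h0 h0)]

/-! ### Probabilities of events -/

section

variable {n m k l : ℕ} {P : Fin k → Binary n} {w : Fin k → ℝ} {q : ℝ}

lemma weight_nonneg (hw : ∀ i, 0 ≤ w i) (h0 : 0 ≤ q) (h1 : q ≤ 1) (ω : Outcome n m k l) :
    0 ≤ weight P w q ω :=
  mul_nonneg (Finset.prod_nonneg fun j _ => mul_nonneg (hw _)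
    (Finset.prod_nonneg fun s _ => by split_ifs <;> linarith)) (by positivity)

/-- Given the initialization the labelled examples are still independent, so a product with one
factor per example integrates factor by factor. `F` may depend on the embedding, which covers events
about the initial templates. -/
lemma sum_weight_mul_prod (F : (Fin l ↪ Fin m) → Fin m → Fin k → Binary n → ℝ) :
    ∑ ω : Outcome n m k l, weight P w q ω * ∏ j, F ω.init j (ω.label j) (ω.ex j)
      = ∑ e : Fin l ↪ Fin m, 1 / (Fintype.card (Fin l ↪ Fin m) : ℝ) *
          ∏ j, exMean P w q (F e j) := by
  rw [← Fintype.sum_equiv (outcomeEquiv n m k l) (fun t => weight P w q ⟨t.1, t.2.1, t.2.2⟩ *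
    ∏ j, F t.2.2 j (t.1 j) (t.2.1 j)) _ (fun t => rfl)]
  simp_rw [Fintype.sum_prod_type]
  rw [Finset.sum_congr rfl fun a _ => Finset.sum_comm, Finset.sum_comm]
  refine Finset.sum_congr rfl fun e _ => ?_
  unfold exMean
  rw [Finset.prod_univ_sum, Fintype.piFinset_univ, Finset.mul_sum]
  refine Finset.sum_congr rfl fun a _ => ?_
  unfold flipMean
  simp_rw [Finset.mul_sum]
  rw [Finset.prod_univ_sum, Fintype.piFinset_univ, Finset.mul_sum]
  refine Finset.sum_congr rfl fun x _ => ?_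
  unfold weight exampleWeight
  rw [mul_right_comm, ← Finset.prod_mul_distrib, mul_comm]
  simp_rw [mul_assoc]

lemma prob_mono (hw : ∀ i, 0 ≤ w i) (h0 : 0 ≤ q) (h1 : q ≤ 1) {A B : Set (Outcome n m k l)}
    (h : A ⊆ B) : prob P w q A ≤ prob P w q B := by
  unfold prob
  refine Finset.sum_le_sum fun ω _ => ?_
  have := weight_nonneg (P := P) hw h0 h1 ω
  by_cases hA : ω ∈ A
  · simp [hA, h hA]
  · rw [if_neg hA]
    split_ifs <;> simp [this]

lemma prob_nonneg (hw : ∀ i, 0 ≤ w i) (h0 : 0 ≤ q) (h1 : q ≤ 1) (A : Set (Outcome n m k l)) :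
    0 ≤ prob P w q A :=
  Finset.sum_nonneg fun ω _ => by
    have := weight_nonneg (P := P) hw h0 h1 ω
    split_ifs <;> simp [this]

lemma prob_union_le (hw : ∀ i, 0 ≤ w i) (h0 : 0 ≤ q) (h1 : q ≤ 1)
    (A B : Set (Outcome n m k l)) : prob P w q (A ∪ B) ≤ prob P w q A + prob P w q B := by
  unfold prob
  rw [← Finset.sum_add_distrib]
  refine Finset.sum_le_sum fun ω _ => ?_
  have := weight_nonneg (P := P) hw h0 h1 ω
  by_cases hA : ω ∈ A <;> by_cases hB : ω ∈ B <;> simp [hA, hB, this]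

lemma prob_exists_le (hw : ∀ i, 0 ≤ w i) (h0 : 0 ≤ q) (h1 : q ≤ 1) {ι : Type*} [Fintype ι]
    (A : ι → Set (Outcome n m k l)) {b : ι → ℝ} (hA : ∀ i, prob P w q (A i) ≤ b i) :
    prob P w q {ω | ∃ i, ω ∈ A i} ≤ ∑ i, b i := by
  classical
  refine le_trans ?_ (Finset.sum_le_sum fun i _ => hA i)
  unfold prob
  rw [Finset.sum_comm]
  refine Finset.sum_le_sum fun ω _ => ?_
  have := weight_nonneg (P := P) hw h0 h1 ω
  have hnn : ∀ i ∈ (Finset.univ : Finset ι), 0 ≤ if ω ∈ A i then weight P w q ω else 0 :=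
    fun i _ => by split_ifs <;> simp [this]
  split_ifs with h
  · obtain ⟨i, hi⟩ := h
    calc weight P w q ω = if ω ∈ A i then weight P w q ω else 0 := by rw [if_pos hi]
      _ ≤ _ := Finset.single_le_sum hnn (Finset.mem_univ i)
  · exact Finset.sum_nonneg hnn

lemma exMean_one (hw : ∑ i, w i = 1) : exMean P w q (fun _ _ => 1) = 1 := by
  unfold exMean
  simp [flipMean_one, hw]

lemma exMean_le (hw : ∀ i, 0 ≤ w i) (hw1 : ∑ i, w i = 1) {f : Fin k → Binary n → ℝ} {b : ℝ}
    (h : ∀ i, flipMean q (P i) (f i) ≤ b) : exMean P w q f ≤ b := by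
  unfold exMean
  calc ∑ i, w i * flipMean q (P i) (f i) ≤ ∑ i, w i * b :=
        Finset.sum_le_sum fun i _ => mul_le_mul_of_nonneg_left (h i) (hw i)
    _ = b := by rw [← Finset.sum_mul, hw1, one_mul]

lemma exMean_label (f : Fin k → ℝ) : exMean P w q (fun i _ => f i) = ∑ i, w i * f i := by
  unfold exMean
  simp_rw [flipMean_const]

lemma exMean_nonneg (hw : ∀ i, 0 ≤ w i) (h0 : 0 ≤ q) (h1 : q ≤ 1)
    {f : Fin k → Binary n → ℝ} (h : ∀ i x, 0 ≤ f i x) : 0 ≤ exMean P w q f :=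
  Finset.sum_nonneg fun i _ => mul_nonneg (hw i)
    (Finset.sum_nonneg fun x _ => mul_nonneg
      (Finset.prod_nonneg fun s _ => by split_ifs <;> linarith) (h i x))

lemma card_embedding_pos (hlm : l ≤ m) : 0 < Fintype.card (Fin l ↪ Fin m) :=
  Fintype.card_pos_iff.2 ⟨Fin.castLEEmb hlm⟩

lemma sum_weight (hlm : l ≤ m) (hw : ∑ i, w i = 1) :
    ∑ ω : Outcome n m k l, weight P w q ω = 1 := by
  have h := sum_weight_mul_prod (P := P) (w := w) (q := q) (m := m) (l := l)
    (fun _ _ _ _ => 1)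
  simp only [Finset.prod_const_one, mul_one, exMean_one hw] at h
  rw [h, Finset.sum_const, nsmul_eq_mul, Finset.card_univ]
  exact mul_one_div_cancel (by exact_mod_cast (card_embedding_pos hlm).ne')

lemma one_le_prob_add_prob_compl (hlm : l ≤ m) (hw : ∑ i, w i = 1)
    (A : Set (Outcome n m k l)) : 1 ≤ prob P w q A + prob P w q Aᶜ := by
  rw [← sum_weight (P := P) (q := q) (n := n) hlm hw]
  unfold prob
  rw [← Finset.sum_add_distrib]
  refine Finset.sum_le_sum fun ω _ => ?_
  by_cases hA : ω ∈ A <;> simp [hA]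

/-- Markov's inequality for products of independent nonnegative quantities. -/
lemma prob_le_of_prod (hlm : l ≤ m) (hw : ∀ i, 0 ≤ w i) (h0 : 0 ≤ q) (h1 : q ≤ 1)
    (A : Set (Outcome n m k l)) (F : (Fin l ↪ Fin m) → Fin m → Fin k → Binary n → ℝ)
    (hF : ∀ e j i x, 0 ≤ F e j i x) {κ b : ℝ} (hκ : 0 ≤ κ)
    (hA : ∀ ω ∈ A, 1 ≤ κ * ∏ j, F ω.init j (ω.label j) (ω.ex j))
    (hb : ∀ e, κ * ∏ j, exMean P w q (F e j) ≤ b) : prob P w q A ≤ b := by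
  calc prob P w q A
      ≤ ∑ ω : Outcome n m k l,
          κ * (weight P w q ω * ∏ j, F ω.init j (ω.label j) (ω.ex j)) := by
        unfold prob
        refine Finset.sum_le_sum fun ω _ => ?_
        have h := weight_nonneg (P := P) hw h0 h1 ω
        split_ifs with hω
        · have := mul_le_mul_of_nonneg_left (hA ω hω) h
          linarith
        · exact mul_nonneg hκ (mul_nonneg h (Finset.prod_nonneg fun j _ => hF _ _ _ _))
    _ = ∑ e : Fin l ↪ Fin m, 1 / (Fintype.card (Fin l ↪ Fin m) : ℝ) *
          (κ * ∏ j, exMean P w q (F e j)) := by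
        rw [← Finset.mul_sum, sum_weight_mul_prod, Finset.mul_sum]
        exact Finset.sum_congr rfl fun e _ => by ring
    _ ≤ ∑ _e : Fin l ↪ Fin m, 1 / (Fintype.card (Fin l ↪ Fin m) : ℝ) * b :=
        Finset.sum_le_sum fun e _ => mul_le_mul_of_nonneg_left (hb e) (by positivity)
    _ = b := by
        rw [Finset.sum_const, nsmul_eq_mul, Finset.card_univ, ← mul_assoc,
          mul_one_div_cancel (by exact_mod_cast (card_embedding_pos hlm).ne'), one_mul]

open Classical in
/-- The union bound over the examples. -/
lemma prob_exists_example_le (hlm : l ≤ m) (hw : ∀ i, 0 ≤ w i) (hw1 : ∑ i, w i = 1)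
    (h0 : 0 ≤ q) (h1 : q ≤ 1) (bad : Fin k → Binary n → Prop) {b : ℝ}
    (hb : ∀ i, flipMean q (P i) (fun x => if bad i x then 1 else 0) ≤ b) :
    prob P w q {ω : Outcome n m k l | ∃ j, bad (ω.label j) (ω.ex j)} ≤ m * b := by
  refine (prob_exists_le hw h0 h1 (fun j => {ω : Outcome n m k l | bad (ω.label j) (ω.ex j)})
    (b := fun _ => b) fun j => ?_).trans (by simp)
  refine prob_le_of_prod hlm hw h0 h1 _
    (fun _ j' i x => if j' = j then (if bad i x then 1 else 0) else 1)
    (fun _ j' i x => by split_ifs <;> norm_num) zero_le_one (fun ω hω => ?_) fun _ => ?_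
  · have hω' : bad (ω.label j) (ω.ex j) := hω
    rw [one_mul, Finset.prod_ite_eq']
    simp [hω']
  · rw [one_mul, Finset.prod_eq_single j]
    · simp only [if_true]
      exact exMean_le hw hw1 hb
    · intro j' _ hj'
      simp only [if_neg hj']
      exact exMean_one hw1
    · simp

/-- The product over the examples chosen for the initialization. -/
lemma prod_exMean_init (hw1 : ∑ i, w i = 1) (e : Fin l ↪ Fin m)
    (f : Fin k → Binary n → ℝ) :
    ∏ j, exMean P w q (fun i x => if j ∈ Set.range e then f i x else 1)
      = exMean P w q f ^ l := by
  classical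
  have h : ∀ j, exMean P w q (fun i x => if j ∈ Set.range e then f i x else 1)
      = if j ∈ Finset.univ.map e then exMean P w q f else 1 := by
    intro j
    by_cases hj : j ∈ Set.range e
    · have hj' : j ∈ Finset.univ.map e := by simpa using hj
      simp only [if_pos hj, if_pos hj']
    · have hj' : ¬ j ∈ Finset.univ.map e := by simpa using hj
      simp only [if_neg hj, if_neg hj']
      exact exMean_one hw1
  simp_rw [h]
  rw [Finset.prod_ite_mem, Finset.univ_inter, Finset.prod_const, Finset.card_map,
    Finset.card_univ, Fintype.card_fin]

lemma prod_init_eq (e : Fin l ↪ Fin m) (f : Fin m → ℝ) :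
    ∏ j, (if j ∈ Set.range e then f j else 1) = ∏ a, f (e a) := by
  classical
  have h : ∀ j, (if j ∈ Set.range e then f j else 1)
      = if j ∈ Finset.univ.map e then f j else 1 := fun j => by
    by_cases hj : j ∈ Set.range e
    · have hj' : j ∈ Finset.univ.map e := by simpa using hj
      simp only [if_pos hj, if_pos hj']
    · have hj' : ¬ j ∈ Finset.univ.map e := by simpa using hj
      simp only [if_neg hj, if_neg hj']
  simp_rw [h]
  rw [Finset.prod_ite_mem, Finset.univ_inter, Finset.prod_map]

end

/-! ### Tail bounds -/

lemma two_mul_three_pow_le_factorial (j : ℕ) : 2 * 3 ^ j ≤ (j + 2).factorial := by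
  induction j with
  | zero => decide
  | succ j ih =>
    rw [Nat.factorial_succ, pow_succ]
    calc 2 * (3 ^ j * 3) = 3 * (2 * 3 ^ j) := by ring
      _ ≤ (j + 2 + 1) * (j + 2).factorial := Nat.mul_le_mul (by omega) ih

/-- From the quadratic term on, the exponential series is dominated by a geometric series of ratio
`x/3`, because `2 * 3 ^ j ≤ (j + 2)!`. -/
lemma exp_sub_one_sub_le {x : ℝ} (h0 : 0 ≤ x) (h3 : x < 3) :
    Real.exp x - 1 - x ≤ x ^ 2 / (2 * (1 - x / 3)) := by
  have h1 : HasSum (fun j : ℕ => x ^ j / (j.factorial : ℝ)) (Real.exp x) := by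
    rw [Real.exp_eq_exp_ℝ]
    exact NormedSpace.expSeries_div_hasSum_exp x
  have h2 := (hasSum_nat_add_iff' 2).2 h1
  have h3' := (hasSum_geometric_of_lt_one (r := x / 3) (by positivity) (by linarith)).mul_left
    (x ^ 2 / 2)
  have h4 := hasSum_le (fun j => ?_) h2 h3'
  · simp [Finset.sum_range_succ] at h4
    have h5 : 0 < 1 - x / 3 := by linarith
    calc Real.exp x - 1 - x = Real.exp x - (1 + x) := by ring
      _ ≤ x ^ 2 / 2 * (1 - x / 3)⁻¹ := by linarith
      _ = _ := by field_simp
  · have h5 : (2 * 3 ^ j : ℝ) ≤ ((j + 2).factorial : ℝ) := by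
      exact_mod_cast two_mul_three_pow_le_factorial j
    calc x ^ (j + 2) / ((j + 2).factorial : ℝ) ≤ x ^ (j + 2) / (2 * 3 ^ j) := by gcongr
      _ = x ^ 2 / 2 * (x / 3) ^ j := by
        rw [pow_add, div_pow]
        field_simp

/-- The deviation from the mean `μ` in Bernstein's inequality at level `exp (-A)`. -/
def dev (μ A : ℝ) : ℝ := 2 / 3 * A + Real.sqrt (2 * μ * A)

open Classical in
/-- Bernstein's inequality for the number of flipped components in `T`. -/
lemma flipMean_tail_le {n : ℕ} {q A : ℝ} (h0 : 0 ≤ q) (h1 : q ≤ 1) (hA : 0 < A) (p : Binary n)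
    (T : Finset (Fin n)) (hμ : 0 < T.card * q) :
    flipMean q p (fun x => if T.card * q + dev (T.card * q) A < flips p T x then 1 else 0)
      ≤ Real.exp (-A) := by
  set μ : ℝ := T.card * q with hμdef
  set s := dev μ A with hs
  have hs0 : 0 < s := by
    unfold dev at hs
    have := Real.sqrt_nonneg (2 * μ * A)
    linarith
  have hv : 0 < μ + s / 3 := by positivity
  -- This is what `dev` is designed for: the Bernstein exponent `s²/(2(μ + s/3))` is at least `A`.
  have hs2 : 2 * A * (μ + s / 3) ≤ s ^ 2 := by
    have hr := Real.sq_sqrt (show 0 ≤ 2 * μ * A by positivity)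
    have hr0 := Real.sqrt_nonneg (2 * μ * A)
    unfold dev at hs
    rw [hs]
    nlinarith [mul_nonneg hA.le hr0]
  -- Chernoff parameter for which the cost `μ(e^η - 1 - η)` is at most half of the gain `ηs`.
  set η := s / (μ + s / 3) with hη
  have hη0 : 0 < η := by positivity
  have hη3 : η < 3 := by
    rw [hη, div_lt_iff₀ hv]
    linarith
  have hb := exp_sub_one_sub_le hη0.le hη3
  have h13 : 1 - η / 3 = μ / (μ + s / 3) := by
    rw [hη]
    field_simp
    ring
  have hφ : μ * (Real.exp η - 1 - η) ≤ s ^ 2 / (2 * (μ + s / 3)) := by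
    calc μ * (Real.exp η - 1 - η) ≤ μ * (η ^ 2 / (2 * (1 - η / 3))) := by gcongr
      _ = s ^ 2 / (2 * (μ + s / 3)) := by
        rw [h13, hη]
        field_simp
  have hηs : η * s = 2 * (s ^ 2 / (2 * (μ + s / 3))) := by
    rw [hη]
    field_simp
  have hA' : A ≤ s ^ 2 / (2 * (μ + s / 3)) := by
    rw [le_div_iff₀ (by positivity)]
    linarith
  calc flipMean q p (fun x => if μ + s < flips p T x then 1 else 0)
      ≤ flipMean q p (fun x => Real.exp (-(η * (μ + s))) * Real.exp (η * flips p T x)) := by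
        refine flipMean_mono h0 h1 p fun x => ?_
        split_ifs with h
        · rw [← Real.exp_add]
          refine Real.one_le_exp ?_
          have := mul_le_mul_of_nonneg_left h.le hη0.le
          linarith
        · positivity
    _ ≤ Real.exp (-(η * (μ + s))) * Real.exp (μ * (Real.exp η - 1)) := by
        rw [flipMean_const_mul]
        exact mul_le_mul_of_nonneg_left (flipMean_exp_flips_le h0 hη0.le p T) (Real.exp_nonneg _)
    _ ≤ Real.exp (-A) := by
        rw [← Real.exp_add, Real.exp_le_exp]
        linarith

/-- The components in which two binary vectors differ. -/
def diffSet {n : ℕ} (x y : Binary n) : Finset (Fin n) := Finset.univ.filter fun s => x s ≠ y s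

lemma D_eq_card_diffSet {n : ℕ} (x y : Binary n) :
    D (toReal x) (toReal y) = (diffSet x y).card := by
  rw [D_toReal, diffSet, Finset.card_filter]
  push_cast
  exact Finset.sum_congr rfl fun s _ => by by_cases h : x s = y s <;> simp [h]

/-- Components where `p` and `p'` agree cancel; the others contribute `1`, or `-1` if switched.
Hence only flips inside `diffSet` matter, and the relevant mean is `D(p, p') q` instead of `n q`. -/
lemma D_sub_D {n : ℕ} (x p p' : Binary n) :
    D (toReal x) (toReal p') - D (toReal x) (toReal p)
      = D (toReal p) (toReal p') - 2 * flips p (diffSet p p') x := by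
  rw [D_toReal, D_toReal, D_toReal, flips, diffSet, Finset.sum_filter, Finset.mul_sum,
    ← Finset.sum_sub_distrib, ← Finset.sum_sub_distrib]
  refine Finset.sum_congr rfl fun s _ => ?_
  cases x s <;> cases p s <;> cases p' s <;> norm_num

/-! ### Probabilities of the exceptional events -/

section

variable {n m k l : ℕ} {P : Fin k → Binary n} {w : Fin k → ℝ} {q : ℝ}

/-- All examples are near their templates. -/
lemma prob_far_from_template_le (hlm : l ≤ m) (hw : ∀ i, 0 ≤ w i) (hw1 : ∑ i, w i = 1)
    (h0 : 0 < q) (h1 : q ≤ 1) {A : ℝ} (hA : 0 < A) (hn : 0 < n) :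
    prob P w q {ω : Outcome n m k l | ∃ j, n * q + dev (n * q) A <
      D (toReal (ω.ex j)) (toReal (P (ω.label j)))} ≤ m * Real.exp (-A) := by
  classical
  refine prob_exists_example_le hlm hw hw1 h0.le h1
    (fun i x => n * q + dev (n * q) A < D (toReal x) (toReal (P i))) fun i => ?_
  have h := flipMean_tail_le h0.le h1 hA (P i) Finset.univ (by
    rw [Finset.card_fin]
    positivity)
  rw [Finset.card_fin] at h
  convert h using 4
  rw [D_eq_flips]

/-- All examples are farther from the other templates than from their own. -/
lemma prob_not_separated_le (hlm : l ≤ m) (hw : ∀ i, 0 ≤ w i) (hw1 : ∑ i, w i = 1)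
    (h0 : 0 < q) (h1 : q ≤ 1) {A : ℝ} (hA : 0 < A)
    (hP : ∀ i i', i ≠ i' → 0 < D (toReal (P i)) (toReal (P i'))) :
    prob P w q {ω : Outcome n m k l | ∃ j, ∃ i, i ≠ ω.label j ∧
      D (toReal (ω.ex j)) (toReal (P i)) < D (toReal (ω.ex j)) (toReal (P (ω.label j))) +
        (D (toReal (P (ω.label j))) (toReal (P i)) * (1 - 2 * q)
          - 2 * dev (D (toReal (P (ω.label j))) (toReal (P i)) * q) A)}
      ≤ m * (k * Real.exp (-A)) := by
  classical
  refine prob_exists_example_le hlm hw hw1 h0.le h1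
    (fun i x => ∃ i', i' ≠ i ∧ D (toReal x) (toReal (P i')) < D (toReal x) (toReal (P i)) +
        (D (toReal (P i)) (toReal (P i')) * (1 - 2 * q)
          - 2 * dev (D (toReal (P i)) (toReal (P i')) * q) A)) fun i => ?_
  calc _ ≤ flipMean q (P i) (fun x => ∑ i', if i' ≠ i ∧
          D (toReal (P i)) (toReal (P i')) * q + dev (D (toReal (P i)) (toReal (P i')) * q) A <
            flips (P i) (diffSet (P i) (P i')) x then 1 else 0) := by
        refine flipMean_mono h0.le h1 _ fun x => ?_
        have hnn : ∀ i' ∈ (Finset.univ : Finset (Fin k)), (0 : ℝ) ≤ if i' ≠ i ∧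
          D (toReal (P i)) (toReal (P i')) * q + dev (D (toReal (P i)) (toReal (P i')) * q) A <
            flips (P i) (diffSet (P i) (P i')) x then 1 else 0 := fun i' _ => by
          split_ifs <;> norm_num
        split_ifs with h
        · obtain ⟨i', hi', h'⟩ := h
          refine le_trans ?_ (Finset.single_le_sum hnn (Finset.mem_univ i'))
          have hx : D (toReal (P i)) (toReal (P i')) * q +
              dev (D (toReal (P i)) (toReal (P i')) * q) A <
                flips (P i) (diffSet (P i) (P i')) x := by
            have := D_sub_D x (P i) (P i')
            linarith
          rw [if_pos ⟨hi', hx⟩]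
        · exact Finset.sum_nonneg hnn
    _ ≤ ∑ _i' : Fin k, Real.exp (-A) := by
        rw [flipMean_sum]
        refine Finset.sum_le_sum fun i' _ => ?_
        by_cases hi' : i' ≠ i
        · have hd := hP i i' (Ne.symm hi')
          rw [D_eq_card_diffSet] at hd ⊢
          have h := flipMean_tail_le h0.le h1 hA (P i) (diffSet (P i) (P i'))
            (mul_pos hd h0)
          simpa only [hi', ne_eq, not_false_iff, true_and] using h
        · simp only [hi', false_and, if_false, flipMean_const]
          positivity
    _ = k * Real.exp (-A) := by simp

lemma sum_label_ite (hw1 : ∑ i, w i = 1) (i : Fin k) (a : ℝ) :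
    ∑ i', w i' * (if i' = i then 1 + a else 1) = 1 + a * w i := by
  have : ∀ i', w i' * (if i' = i then 1 + a else 1) = w i' + if i' = i then a * w i' else 0 := by
    intro i'
    split_ifs <;> ring
  simp_rw [this]
  rw [Finset.sum_add_distrib, hw1, Finset.sum_ite_eq' Finset.univ i]
  simp

/-- Every template generates many examples. -/
lemma prob_card_S_lt_le (hlm : l ≤ m) (hw : ∀ i, 0 ≤ w i) (hw1 : ∑ i, w i = 1)
    (h0 : 0 ≤ q) (h1 : q ≤ 1) (i : Fin k) :
    prob P w q {ω : Outcome n m k l | ((S ω i).card : ℝ) < m * w i / 2}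
      ≤ Real.exp (-(m * w i / 8)) := by
  classical
  -- Chernoff bound with a factor `1/2` for each example of cluster `i`; the exponent works because
  -- `(log 2 - 1)/2 ≤ -1/8`.
  refine prob_le_of_prod hlm hw h0 h1 _
    (fun _ _ i' _ => if i' = i then 1 + (-1 / 2) else 1)
    (fun _ _ i' _ => by split_ifs <;> norm_num)
    (κ := Real.exp (Real.log 2 * (m * w i / 2))) (Real.exp_nonneg _) (fun ω hω => ?_) fun _ => ?_
  · have hω' : ((S ω i).card : ℝ) < m * w i / 2 := hω
    have e : ∏ j, (if ω.label j = i then 1 + (-1 / 2 : ℝ) else 1)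
        = Real.exp (-(Real.log 2 * (S ω i).card)) := by
      rw [← Finset.prod_filter, Finset.prod_const]
      change _ ^ (S ω i).card = _
      rw [← neg_mul, mul_comm, Real.exp_nat_mul, Real.exp_neg, Real.exp_log (by norm_num)]
      norm_num
    rw [e, ← Real.exp_add]
    refine Real.one_le_exp ?_
    have := mul_le_mul_of_nonneg_left hω'.le (Real.log_nonneg (show (1 : ℝ) ≤ 2 by norm_num))
    linarith
  · have e : exMean P w q (fun i' _ => if i' = i then 1 + (-1 / 2 : ℝ) else 1)
        ≤ Real.exp (-(w i / 2)) := by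
      rw [exMean_label, sum_label_ite hw1]
      linarith [Real.add_one_le_exp (-(w i / 2))]
    have e0 : 0 ≤ exMean P w q (fun i' _ => if i' = i then 1 + (-1 / 2 : ℝ) else 1) :=
      exMean_nonneg hw h0 h1 fun i' _ => by split_ifs <;> norm_num
    rw [Finset.prod_const, Finset.card_univ, Fintype.card_fin]
    calc _ ≤ Real.exp (Real.log 2 * (m * w i / 2)) * Real.exp (-(w i / 2)) ^ m := by gcongr
      _ ≤ _ := by
        rw [← Real.exp_nat_mul, ← Real.exp_add, Real.exp_le_exp]
        have h2 := Real.log_two_lt_d9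
        have hmw : 0 ≤ m * w i := mul_nonneg (Nat.cast_nonneg _) (hw i)
        nlinarith

/-- Every template generates an initial template. -/
lemma prob_no_init_le (hlm : l ≤ m) (hw : ∀ i, 0 ≤ w i) (hw1 : ∑ i, w i = 1)
    (h0 : 0 ≤ q) (h1 : q ≤ 1) (i : Fin k) :
    prob P w q {ω : Outcome n m k l | ∀ a, ω.label (ω.init a) ≠ i}
      ≤ Real.exp (-(l * w i)) := by
  classical
  refine prob_le_of_prod hlm hw h0 h1 _
    (fun e j i' x => if j ∈ Set.range e then (if i' = i then 1 + (-1) else 1) else 1)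
    (fun _ _ i' _ => by split_ifs <;> norm_num) zero_le_one (fun ω hω => ?_) fun e => ?_
  · have hω' : ∀ a, ω.label (ω.init a) ≠ i := hω
    rw [prod_init_eq ω.init (fun j => if ω.label j = i then 1 + (-1 : ℝ) else 1)]
    simp [hω']
  · rw [prod_exMean_init hw1 e (fun i' _ => if i' = i then 1 + (-1 : ℝ) else 1), one_mul,
      ← mul_neg, Real.exp_nat_mul]
    refine pow_le_pow_left₀ (exMean_nonneg hw h0 h1 fun i' _ => by split_ifs <;> norm_num) ?_ _
    rw [exMean_label, sum_label_ite hw1]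
    linarith [Real.add_one_le_exp (-(w i))]

lemma log_three_halves_gt : 0.4 < Real.log (3 / 2) := by
  have h : 7 * Real.log 2 ≤ 12 * Real.log (3 / 2) := by
    have := Real.log_le_log (by norm_num) (show (2 : ℝ) ^ 7 ≤ (3 / 2) ^ 12 by norm_num)
    rw [Real.log_pow, Real.log_pow] at this
    exact_mod_cast this
  have := Real.log_two_gt_d9
  linarith

/-- No template generates too many initial templates. -/
lemma prob_many_init_le (hlm : l ≤ m) (hw : ∀ i, 0 ≤ w i) (hw1 : ∑ i, w i = 1)
    (h0 : 0 ≤ q) (h1 : q ≤ 1) (i : Fin k) :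
    prob P w q {ω : Outcome n m k l | 3 / 2 * l * w i <
      ((Finset.univ.filter fun a => ω.label (ω.init a) = i).card : ℝ)}
      ≤ Real.exp (-(l * w i / 12)) := by
  classical
  -- Chernoff bound with a factor `3/2` for each initial template of cluster `i`; `(3/2) log (3/2) >
  -- 0.6` exceeds `1/2 + 1/12`.
  refine prob_le_of_prod hlm hw h0 h1 _
    (fun e j i' x => if j ∈ Set.range e then (if i' = i then 1 + 1 / 2 else 1) else 1)
    (fun _ _ i' _ => by split_ifs <;> norm_num)
    (κ := Real.exp (-(Real.log (3 / 2) * (3 / 2 * l * w i)))) (Real.exp_nonneg _)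
    (fun ω hω => ?_) fun e => ?_
  · have hω' : 3 / 2 * l * w i <
      ((Finset.univ.filter fun a => ω.label (ω.init a) = i).card : ℝ) := hω
    rw [prod_init_eq ω.init (fun j => if ω.label j = i then 1 + (1 / 2 : ℝ) else 1),
      ← Finset.prod_filter, Finset.prod_const]
    have e : (1 + 1 / 2 : ℝ) ^ (Finset.univ.filter fun a => ω.label (ω.init a) = i).card
        = Real.exp (Real.log (3 / 2) *
          (Finset.univ.filter fun a => ω.label (ω.init a) = i).card) := by
      rw [mul_comm, Real.exp_nat_mul, Real.exp_log (by norm_num)]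
      norm_num
    rw [e, ← Real.exp_add]
    refine Real.one_le_exp ?_
    have := mul_le_mul_of_nonneg_left hω'.le
      (Real.log_nonneg (show (1 : ℝ) ≤ 3 / 2 by norm_num))
    linarith
  · rw [prod_exMean_init hw1 e (fun i' _ => if i' = i then 1 + (1 / 2 : ℝ) else 1)]
    have e1 : exMean P w q (fun i' _ => if i' = i then 1 + (1 / 2 : ℝ) else 1)
        ≤ Real.exp (w i / 2) := by
      rw [exMean_label, sum_label_ite hw1]
      linarith [Real.add_one_le_exp (w i / 2)]
    have e0 : 0 ≤ exMean P w q (fun i' _ => if i' = i then 1 + (1 / 2 : ℝ) else 1) :=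
      exMean_nonneg hw h0 h1 fun i' _ => by split_ifs <;> norm_num
    calc _ ≤ Real.exp (-(Real.log (3 / 2) * (3 / 2 * l * w i))) * Real.exp (w i / 2) ^ l := by
          gcongr
      _ ≤ _ := by
        rw [← Real.exp_nat_mul, ← Real.exp_add, Real.exp_le_exp]
        have h2 := log_three_halves_gt
        have hlw : 0 ≤ l * w i := mul_nonneg (Nat.cast_nonneg _) (hw i)
        nlinarith

/-- More than `k` of the initial templates are within `5 / 2` standard deviations. -/
lemma prob_bad_init_le (hlm : l ≤ m) (hw : ∀ i, 0 ≤ w i) (hw1 : ∑ i, w i = 1)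
    (h0 : 0 < q) (h1 : q ≤ 1) (hn : 0 < n) (hkl : 8 * k ≤ l) :
    prob P w q {ω : Outcome n m k l | l ≤ k + (Finset.univ.filter fun a =>
      n * q + 5 / 2 * Real.sqrt (n * q) <
        D (T0 ω a) (toReal (P (ω.label (ω.init a))))).card} ≤ Real.exp (-(l / 2)) := by
  classical
  set τ : ℝ := n * q + 5 / 2 * Real.sqrt (n * q) with hτ
  have hnq : 0 < n * q := by positivity
  refine prob_le_of_prod hlm hw h0.le h1 _
    (fun e j i x => if j ∈ Set.range e then
      (if τ < D (toReal x) (toReal (P i)) then 4 else 1) else 1)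
    (fun _ _ i' _ => by split_ifs <;> norm_num)
    (κ := (1 / 4) ^ (l - k)) (by positivity) (fun ω hω => ?_) fun e => ?_
  · have hω' : l ≤ k + (Finset.univ.filter fun a => τ <
        D (T0 ω a) (toReal (P (ω.label (ω.init a))))).card := hω
    rw [prod_init_eq ω.init
      (fun j => if τ < D (toReal (ω.ex j)) (toReal (P (ω.label j))) then (4 : ℝ) else 1),
      ← Finset.prod_filter, Finset.prod_const]
    change 1 ≤ (1 / 4 : ℝ) ^ (l - k) * 4 ^ (Finset.univ.filter fun a => τ <
        D (T0 ω a) (toReal (P (ω.label (ω.init a))))).card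
    calc (1 : ℝ) = (1 / 4) ^ (l - k) * 4 ^ (l - k) := by rw [← mul_pow]; norm_num
      _ ≤ _ := by
        gcongr
        · norm_num
        · omega
  · rw [prod_exMean_init hw1 e
      (fun i x => if τ < D (toReal x) (toReal (P i)) then (4 : ℝ) else 1)]
    -- Chebyshev: a deviation beyond `(5/2)√(nq)` has probability at most `4/25`, and each bad
    -- example carries the factor 4, so the mean is at most `1 + 3 · 4/25`.
    have e1 : exMean P w q (fun i x => if τ < D (toReal x) (toReal (P i)) then (4 : ℝ) else 1)
        ≤ 37 / 25 := by
      refine exMean_le hw hw1 fun i => ?_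
      calc _ ≤ flipMean q (P i) (fun x => 1 + 12 / (25 * (n * q)) *
            (flips (P i) Finset.univ x - n * q) ^ 2) := by
            refine flipMean_mono h0.le h1 _ fun x => ?_
            rw [D_eq_flips]
            split_ifs with h
            · have hs := Real.sq_sqrt hnq.le
              have hs0 := Real.sqrt_nonneg (n * q)
              have h2 : (5 / 2 * Real.sqrt (n * q)) ^ 2 ≤
                  (flips (P i) Finset.univ x - n * q) ^ 2 :=
                pow_le_pow_left₀ (by positivity) (by linarith) 2
              rw [mul_pow, hs] at h2
              have h3 : 12 / (25 * (n * q)) * ((5 / 2) ^ 2 * (n * q)) = 3 := by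
                field_simp
                norm_num
              have h4 := mul_le_mul_of_nonneg_left h2
                (show 0 ≤ 12 / (25 * (n * q)) by positivity)
              linarith
            · have : 0 ≤ 12 / (25 * (n * q)) * (flips (P i) Finset.univ x - n * q) ^ 2 := by
                positivity
              linarith
        _ ≤ 1 + 12 / (25 * (n * q)) * (n * q) := by
            rw [flipMean_add, flipMean_one, flipMean_const_mul]
            gcongr
            exact flipMean_sq_le h0.le _
        _ = 37 / 25 := by
            field_simp
            norm_num
    have e0 : 0 ≤ exMean P w q
        (fun i x => if τ < D (toReal x) (toReal (P i)) then (4 : ℝ) else 1) :=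
      exMean_nonneg hw h0.le h1 fun i' _ => by split_ifs <;> norm_num
    calc _ ≤ (1 / 4 : ℝ) ^ (l - k) * (37 / 25) ^ l := by gcongr
      _ ≤ _ := by
        -- Eighth powers make `l - k ≥ 7l/8` a statement about integer exponents.
        refine le_of_pow_le_pow_left₀ (n := 8) (by norm_num) (Real.exp_nonneg _) ?_
        calc ((1 / 4 : ℝ) ^ (l - k) * (37 / 25) ^ l) ^ 8
            = (1 / 4) ^ ((l - k) * 8) * ((37 / 25) ^ 8) ^ l := by
              rw [mul_pow, ← pow_mul, ← pow_mul, ← pow_mul, mul_comm l 8]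
          _ ≤ (1 / 4) ^ (7 * l) * ((37 / 25) ^ 8) ^ l := by
              refine mul_le_mul_of_nonneg_right ?_ (by positivity)
              exact pow_le_pow_of_le_one (by norm_num) (by norm_num) (by omega)
          _ = ((1 / 4) ^ 7 * (37 / 25) ^ 8) ^ l := by rw [pow_mul, ← mul_pow]
          _ ≤ Real.exp (-4) ^ l := by
              gcongr
              rw [Real.exp_neg, le_inv_comm₀ (by norm_num) (Real.exp_pos _)]
              have : Real.exp 4 = Real.exp 1 ^ 4 := by rw [← Real.exp_nat_mul]; norm_num
              rw [this]
              calc Real.exp 1 ^ 4 ≤ 3 ^ 4 := by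
                    have := Real.exp_one_lt_d9
                    gcongr
                    linarith
                _ ≤ _ := by norm_num
          _ = Real.exp (-(l / 2)) ^ 8 := by
              rw [← Real.exp_nat_mul, ← Real.exp_nat_mul]
              congr 1
              push_cast
              ring

/-- The total excess of the distances of the examples from their templates is small. -/
lemma prob_excess_le (hlm : l ≤ m) (hw : ∀ i, 0 ≤ w i) (hw1 : ∑ i, w i = 1)
    (h0 : 0 < q) (h1 : q ≤ 1) (hl : 17 ≤ l) (hlnq : (l : ℝ) ≤ n * q) :
    prob P w q {ω : Outcome n m k l | m / (4 * (l : ℝ)) * (Real.sqrt (6 * l * (n * q)) / 2) <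
      ∑ j, max (D (toReal (ω.ex j)) (toReal (P (ω.label j))) - n * q
        - Real.sqrt (6 * l * (n * q))) 0} ≤ Real.exp (-(m / 16)) := by
  have hl' : (17 : ℝ) ≤ l := by exact_mod_cast hl
  have hnq : 0 < n * q := by linarith
  set μ : ℝ := n * q with hμ
  set y := Real.sqrt (6 * l * μ) with hy
  -- Chosen so that `η²μ = l`: the second-order cost of the exponential moment is at most `l`, while
  -- the offset `y` gains `ηy ≥ 2.4 l`.
  set η := Real.sqrt (l / μ) with hη
  have hη0 : 0 ≤ η := Real.sqrt_nonneg _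
  have hη1 : η ≤ 1 := Real.sqrt_le_one.2 ((div_le_one hnq).2 hlnq)
  have hηsq : η ^ 2 * μ = l := by
    rw [hη, Real.sq_sqrt (by positivity)]
    field_simp
  have hηy : 2.4 * l ≤ η * y := by
    rw [hη, hy, ← Real.sqrt_mul (by positivity)]
    refine Real.le_sqrt_of_sq_le ?_
    have : l / μ * (6 * l * μ) = 6 * (l : ℝ) ^ 2 := by field_simp
    rw [this]
    nlinarith
  refine prob_le_of_prod hlm hw h0.le h1 _
    (fun _ _ i x => Real.exp (η * max (D (toReal x) (toReal (P i)) - μ - y) 0))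
    (fun _ _ i' _ => Real.exp_nonneg _)
    (κ := Real.exp (-(η * (m / (4 * (l : ℝ)) * (y / 2))))) (Real.exp_nonneg _)
    (fun ω hω => ?_) fun e => ?_
  · rw [← Real.exp_sum, ← Real.exp_add, ← Finset.mul_sum]
    refine Real.one_le_exp ?_
    have := mul_le_mul_of_nonneg_left (le_of_lt hω) hη0
    linarith
  · have e1 : exMean P w q
        (fun i x => Real.exp (η * max (D (toReal x) (toReal (P i)) - μ - y) 0))
        ≤ Real.exp 0.1 := by
      refine exMean_le hw hw1 fun i => ?_
      calc _ ≤ flipMean q (P i) (fun x => 1 + Real.exp (-(η * (μ + y))) *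
            Real.exp (η * flips (P i) Finset.univ x)) := by
            refine flipMean_mono h0.le h1 _ fun x => ?_
            rw [← Real.exp_add, ← D_eq_flips]
            rcases le_total (D (toReal x) (toReal (P i)) - μ - y) 0 with h | h
            · rw [max_eq_right h, mul_zero, Real.exp_zero]
              linarith [Real.exp_pos (-(η * (μ + y)) + η * D (toReal x) (toReal (P i)))]
            · rw [max_eq_left h]
              have : η * (D (toReal x) (toReal (P i)) - μ - y)
                  = -(η * (μ + y)) + η * D (toReal x) (toReal (P i)) := by ring
              rw [this]
              linarith
        _ ≤ 1 + Real.exp (-(η * (μ + y))) * Real.exp (μ * (Real.exp η - 1)) := by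
            rw [flipMean_add, flipMean_one, flipMean_const_mul]
            have := flipMean_exp_flips_le h0.le hη0 (P i) Finset.univ
            rw [Finset.card_fin] at this
            gcongr
        _ ≤ 1 + 0.1 := by
            rw [← Real.exp_add]
            have h2 : Real.exp η - 1 - η ≤ η ^ 2 := by
              have := Real.abs_exp_sub_one_sub_id_le (x := η) (by rwa [abs_of_nonneg hη0])
              exact (le_abs_self _).trans this
            have h3 : μ * (Real.exp η - 1 - η) ≤ l := by
              calc μ * (Real.exp η - 1 - η) ≤ μ * η ^ 2 := by gcongr
                _ = l := by rw [mul_comm, hηsq]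
            -- The exponent is at most `l - 2.4 l`, and `l ≥ 17`.
            have h4 : Real.exp (-(η * (μ + y)) + μ * (Real.exp η - 1)) ≤ Real.exp (-10) := by
              rw [Real.exp_le_exp]
              nlinarith
            have h5 : Real.exp (-10) ≤ 0.1 := by
              rw [Real.exp_neg, inv_le_comm₀ (Real.exp_pos _) (by norm_num)]
              have := Real.add_one_le_exp (10 : ℝ)
              norm_num at this ⊢
              linarith
            linarith
        _ ≤ Real.exp 0.1 := by
            have := Real.add_one_le_exp (0.1 : ℝ)
            linarith
    have e0 : 0 ≤ exMean P w q
        (fun i x => Real.exp (η * max (D (toReal x) (toReal (P i)) - μ - y) 0)) :=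
      exMean_nonneg hw h0.le h1 fun i' _ => Real.exp_nonneg _
    rw [Finset.prod_const, Finset.card_univ, Fintype.card_fin]
    calc _ ≤ Real.exp (-(η * (m / (4 * (l : ℝ)) * (y / 2)))) * Real.exp 0.1 ^ m := by gcongr
      _ ≤ _ := by
        rw [← Real.exp_nat_mul, ← Real.exp_add, Real.exp_le_exp]
        -- Markov gains at least `0.3 m` in the exponent, the moments cost `0.1 m`.
        have h2 : (m : ℝ) / (8 * l) * (2.4 * l) ≤ m / (8 * l) * (η * y) := by gcongr
        have h3 : (m : ℝ) / (8 * l) * (2.4 * l) = 0.3 * m := by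
          field_simp
          norm_num
          ring
        have h4 : η * (m / (4 * (l : ℝ)) * (y / 2)) = m / (8 * l) * (η * y) := by
          field_simp
          ring
        have hm0 : (0 : ℝ) ≤ m := Nat.cast_nonneg m
        rw [h4]
        linarith

end

/-! ### Numerical estimates -/

/-- The parameters for which the bound of the theorem is not trivial. Here `N`, `L` stand for the
dimension and the number of initial templates. -/
structure Params (N L q c e : ℝ) : Prop where
  q_pos : 0 < q
  q_le : q ≤ 3 / 14
  c_le : c ≤ 1
  e_pos : 0 < e
  e_le : e ≤ 1 / 4
  L_ge : 17 ≤ L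
  N_ge : 920 ≤ N
  Nc_ge : 460 ≤ N * c
  sep : 4 * q + 8 * Real.sqrt (6 * q * L / N) < c
  e_bound : e * (c * (1 - 2 * q) + q + Real.sqrt q) ≤
    3 * c * (1 - 2 * q) / 4 - 2 * q - 4 * Real.sqrt (6 * q * L / N)

/-- A lower bound for the relative gap between the distances of an example from another template
and from its own. -/
def gap (q e : ℝ) : ℝ := (1 - 2 * q) - 4 / 9 * e ^ 2 - 1.64 * e * Real.sqrt q

/-- The exponent in the tail bounds. -/
def tailExp (N c e : ℝ) : ℝ := N * min c 0.5 * e ^ 2 / 3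

/-- Both terms of `dev` become proportional to `d`; the constant is valid because `0.82² > 2/3`. -/
lemma dev_le {μ A d e a b : ℝ} (hd : 0 ≤ d) (he : 0 ≤ e) (ha : 0 ≤ a) (hb : 0 ≤ b)
    (hμ : μ = d * a ^ 2) (hA : A ≤ d * b ^ 2 * e ^ 2 / 3) :
    dev μ A ≤ d * (2 / 9 * b ^ 2 * e ^ 2 + 0.82 * e * a * b) := by
  have h : Real.sqrt (2 * μ * A) ≤ d * (0.82 * e * a * b) := by
    refine Real.sqrt_le_iff.2 ⟨by positivity, ?_⟩
    have h1 : 2 * μ * A ≤ 2 * μ * (d * b ^ 2 * e ^ 2 / 3) := by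
      rw [hμ]
      gcongr
    have h2 : 0 ≤ (d * e * a * b) ^ 2 := sq_nonneg _
    calc 2 * μ * A ≤ _ := h1
      _ = 2 / 3 * (d * e * a * b) ^ 2 := by rw [hμ]; ring
      _ ≤ 0.82 ^ 2 * (d * e * a * b) ^ 2 := by nlinarith
      _ = _ := by ring
  unfold dev
  linarith

/-! ### Separation gaps, cluster radii and noise bounds -/

namespace Params

variable {N L q c e : ℝ}

lemma N_pos (h : Params N L q c e) : 0 < N := by linarith [h.N_ge]

lemma L_pos (h : Params N L q c e) : 0 < L := by linarith [h.L_ge]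

lemma sqrt_pos (h : Params N L q c e) : 0 < Real.sqrt q := Real.sqrt_pos.2 h.q_pos

lemma sq_sqrt (h : Params N L q c e) : Real.sqrt q ^ 2 = q := Real.sq_sqrt h.q_pos.le

lemma sqrt_le (h : Params N L q c e) : Real.sqrt q ≤ 0.463 := by
  refine Real.sqrt_le_iff.2 ⟨by norm_num, ?_⟩
  have := h.q_le
  norm_num at this ⊢
  linarith

lemma four_mul_le (h : Params N L q c e) : 4 * q < c := by
  have := Real.sqrt_nonneg (6 * q * L / N)
  linarith [h.sep]

lemma c_pos (h : Params N L q c e) : 0 < c := by linarith [h.four_mul_le, h.q_pos]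

lemma min_pos (h : Params N L q c e) : 0 < min c 0.5 := lt_min h.c_pos (by norm_num)

lemma tailExp_pos (h : Params N L q c e) : 0 < tailExp N c e := by
  have := h.N_pos
  have := h.min_pos
  have := h.e_pos
  unfold tailExp
  positivity

/-- Square `sep` and use `c² ≤ c`; here `384 = 6 · 8²`. -/
lemma lq_le (h : Params N L q c e) : L * q / N ≤ c / 384 := by
  have h1 : Real.sqrt (6 * q * L / N) ^ 2 = 6 * q * L / N :=
    Real.sq_sqrt (by have := h.N_pos; have := h.L_pos; have := h.q_pos; positivity)
  have h0 := Real.sqrt_nonneg (6 * q * L / N)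
  have h2 := h.sep
  have h3 := h.c_le
  have h4 := h.q_pos
  have h5 : L * q / N = Real.sqrt (6 * q * L / N) ^ 2 / 6 := by rw [h1]; ring
  rw [h5]
  nlinarith

lemma gap_pos (h : Params N L q c e) : 0.3 ≤ gap q e := by
  have h1 := h.sqrt_le
  have h2 := h.q_le
  have h3 := h.e_le
  have h4 := h.e_pos
  have h5 := h.sqrt_pos
  unfold gap
  nlinarith [mul_le_mul h3 h1 h5.le (by norm_num)]

/-- Examples are separated from the other templates. -/
lemma mul_gap_le (h : Params N L q c e) {d : ℝ} (hd : N * c ≤ d) :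
    N * c * gap q e ≤ d * (1 - 2 * q) - 2 * dev (d * q) (tailExp N c e) := by
  have hd0 : 0 ≤ d := (mul_nonneg h.N_pos.le h.c_pos.le).trans hd
  have h1 := dev_le (μ := d * q) (A := tailExp N c e) (b := 1) hd0 h.e_pos.le h.sqrt_pos.le
    zero_le_one (by rw [h.sq_sqrt]) (by
      unfold tailExp
      have : N * min c 0.5 ≤ d := (mul_le_mul_of_nonneg_left (min_le_left _ _) h.N_pos.le).trans hd
      rw [one_pow, mul_one]
      gcongr)
  have h2 : N * c * gap q e ≤ d * gap q e :=
    mul_le_mul_of_nonneg_right hd (by linarith [h.gap_pos])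
  unfold gap at h2 ⊢
  linarith

lemma dev_le_mul (h : Params N L q c e) :
    dev (N * q) (tailExp N c e) ≤ N * (2 / 9 * min c 0.5 * e ^ 2 +
      0.82 * e * Real.sqrt q * Real.sqrt (min c 0.5)) := by
  have hb := Real.sq_sqrt h.min_pos.le
  have h1 := dev_le (μ := N * q) (A := tailExp N c e) (b := Real.sqrt (min c 0.5)) h.N_pos.le
    h.e_pos.le h.sqrt_pos.le (Real.sqrt_nonneg _) (by rw [h.sq_sqrt]) (by rw [hb]; rfl)
  rwa [hb] at h1

/-- The polynomial inequality behind the separation of the initial templates. -/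
lemma poly_aux {a b c e κ : ℝ} (ha : 0 < a) (hac : 4 * a ^ 2 ≤ c) (hc : c ≤ 1)
    (ha' : a ^ 2 ≤ 3 / 14) (hbc : b ^ 2 ≤ c) (hb' : b ^ 2 ≤ 1 / 2) (he : 0 < e)
    (he' : e ≤ 1 / 4) (hκ : κ ≤ 1 / 7) (hκ' : 1 / 16 < κ → a ^ 2 ≤ 1 / 10)
    (hE : e * (c * (1 - 2 * a ^ 2) + a ^ 2 + a) ≤ 3 * c * (1 - 2 * a ^ 2) / 4 - 2 * a ^ 2) :
    κ * c ≤ c * ((1 - 2 * a ^ 2) - 4 / 9 * e ^ 2 - 1.64 * e * a)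
      - 2 * a ^ 2 - 2 * (2 / 9 * b ^ 2 * e ^ 2 + 0.82 * e * a * b) := by
  have hc0 : 0 < c := by nlinarith
  have hb2 : b ≤ 0.7072 := abs_le_of_sq_le_sq' (by norm_num; linarith) (by norm_num) |>.2
  have hb3 : b ≤ c + 1 / 4 := by nlinarith [sq_nonneg (b - 1 / 2)]
  have ha3 : a ≤ 0.463 := abs_le_of_sq_le_sq' (by norm_num; linarith) (by norm_num) |>.2
  set β := c * (1 - 2 * a ^ 2) + a ^ 2 + a - 1.64 * a * c - 1.64 * a * b - 2 / 9 * c with hβ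
  -- By `hE` and `e² ≤ e/4` the right-hand side is at least `c(1 - 2a²)/4 + eβ`, which is affine in
  -- `e`. It suffices to compare at `e = 1/4` (`hend`) and at `e = 0` (`hstart`), both stated after
  -- multiplication by 4.
  have hend : 4 * κ * c ≤ c * (1 - 2 * a ^ 2) + β := by
    rcases le_or_gt κ (1 / 16) with hk | hk
    · have h4 : 4 * κ * c ≤ 1 / 4 * c := by nlinarith
      refine h4.trans ?_
      rw [hβ]
      rcases le_total a 0.3 with h | h
      · have h5 : a * b ≤ a * (c + 1 / 4) := by gcongr
        have h6 : 0 ≤ c * (0.3 - a) := mul_nonneg hc0.le (by linarith)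
        have h7 : 0 ≤ c * (0.3 - a) * a := mul_nonneg h6 ha.le
        nlinarith
      · have h5 : a * b ≤ a * 0.7072 := by gcongr
        have h6 : 0 ≤ (1 - c) * (c - 4 * a ^ 2) := mul_nonneg (by linarith) (by linarith)
        have h7 : 0 ≤ c * ((a - 0.3) * (0.463 - a)) :=
          mul_nonneg hc0.le (mul_nonneg (by linarith) (by linarith))
        have h8 : 0 ≤ (a - 0.3) * (0.463 - a) := mul_nonneg (by linarith) (by linarith)
        nlinarith
    · have ha4 := hκ' hk
      have ha5 : a ≤ 0.3163 := abs_le_of_sq_le_sq' (by norm_num; linarith) (by norm_num) |>.2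
      have h4 : 4 * κ * c ≤ 4 / 7 * c := by nlinarith
      refine h4.trans ?_
      rw [hβ]
      rcases le_total a 0.2 with h | h
      · have h5 : a * b ≤ a * (c + 1 / 4) := by gcongr
        have h6 : 0 ≤ c * (0.2 - a) := mul_nonneg hc0.le (by linarith)
        have h7 : 0 ≤ c * (0.2 - a) * a := mul_nonneg h6 ha.le
        nlinarith
      · have h5 : a * b ≤ a * 0.7072 := by gcongr
        have h7 : 0 ≤ c * ((a - 0.2) * (0.3163 - a)) :=
          mul_nonneg hc0.le (mul_nonneg (by linarith) (by linarith))
        have h8 : 0 ≤ c * (0.3163 - a) := mul_nonneg hc0.le (by linarith)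
        nlinarith
  have hstart : 4 * κ * c ≤ c * (1 - 2 * a ^ 2) := by nlinarith
  have hlin : κ * c ≤ 1 / 4 * (c * (1 - 2 * a ^ 2)) + e * β := by
    have h1 := mul_le_mul_of_nonneg_left hend he.le
    have h2 := mul_le_mul_of_nonneg_left hstart (show 0 ≤ 1 / 4 - e by linarith)
    linarith
  have hee : e ^ 2 ≤ e / 4 := by nlinarith
  have h1 : c * e ^ 2 ≤ c * (e / 4) := by gcongr
  have h2 : b ^ 2 * e ^ 2 ≤ c * (e / 4) := by gcongr
  rw [hβ] at hlin
  linarith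

/-- The distances of an example from initial templates of different clusters differ. -/
lemma le_gap_sub (h : Params N L q c e) {κ : ℝ} (hκ : κ ≤ 1 / 7)
    (hκ' : 1 / 16 < κ → q ≤ 1 / 10) :
    κ * (N * c) ≤ N * c * gap q e - 2 * (N * q + dev (N * q) (tailExp N c e)) := by
  have hb := Real.sq_sqrt h.min_pos.le
  have hN := h.N_pos
  have h1 := poly_aux (a := Real.sqrt q) (b := Real.sqrt (min c 0.5)) (c := c) (e := e)
    h.sqrt_pos (by rw [h.sq_sqrt]; exact h.four_mul_le.le) h.c_le
    (by rw [h.sq_sqrt]; exact h.q_le) (by rw [hb]; exact min_le_left _ _)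
    (by rw [hb]; exact (min_le_right _ _).trans (by norm_num)) h.e_pos h.e_le hκ
    (by rw [h.sq_sqrt]; exact hκ') (by
      rw [h.sq_sqrt]
      have := Real.sqrt_nonneg (6 * q * L / N)
      linarith [h.e_bound])
  rw [h.sq_sqrt, hb] at h1
  have h2 := mul_le_mul_of_nonneg_left h1 hN.le
  have h3 := h.dev_le_mul
  unfold gap
  linarith

lemma mul_sqrt_div (h : Params N L q c e) :
    Real.sqrt (6 * L * (N * q)) = N * Real.sqrt (6 * q * L / N) := by
  have hN := h.N_pos
  rw [← Real.sqrt_sq hN.le, ← Real.sqrt_mul (sq_nonneg N), Real.sqrt_sq hN.le]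
  congr 1
  field_simp

/-- `e_bound` pays for `2q + 4√(6qL/N)` with three quarters of `c(1 - 2q)` and leaves a surplus
proportional to `e`, which absorbs the error terms of `gap`. -/
lemma gap_sub_of_large (h : Params N L q c e) :
    N * c * (1 - 2 * q) / 4 ≤
      N * c * gap q e - 2 * (N * q + 2 * Real.sqrt (6 * L * (N * q))) := by
  have hN := h.N_pos
  rw [h.mul_sqrt_div]
  have h1 := h.e_bound
  have ha := h.sqrt_pos
  have ha' := h.sqrt_le
  have h2 : 0 ≤ e * (c * (1 - 2 * q) + q + Real.sqrt q - 4 / 9 * c * e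
      - 1.64 * Real.sqrt q * c) := by
    refine mul_nonneg h.e_pos.le ?_
    have h3 : Real.sqrt q * c ≤ 0.463 * c := by have := h.c_pos; gcongr
    have h4 : Real.sqrt q * c ≤ Real.sqrt q := mul_le_of_le_one_right ha.le h.c_le
    have h5 : c * e ≤ c * (1 / 4) := by have := h.c_pos; have := h.e_le; gcongr
    have h6 : c * q ≤ c * (3 / 14) := by have := h.c_pos; have := h.q_le; gcongr
    linarith [h.q_pos, h.c_pos]
  have h3 : c * (1 - 2 * q) / 4 ≤ c * gap q e - 2 * (q + 2 * Real.sqrt (6 * q * L / N)) := by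
    unfold gap
    linarith
  have h4 := mul_le_mul_of_nonneg_left h3 hN.le
  linarith

/-- After division by `N` this is exactly `sep`. -/
lemma four_radius_lt_of_large (h : Params N L q c e) :
    4 * (N * q + 2 * Real.sqrt (6 * L * (N * q))) < N * c := by
  rw [h.mul_sqrt_div]
  have := mul_lt_mul_of_pos_left h.sep h.N_pos
  linarith

/-- If `Nq ≤ L`, the square root in `sep` is at least `2.4 q`. Thus `q` is small compared with `c`,
and the crude radius is affordable. -/
lemma radius_le_of_small (h : Params N L q c e) (hs : N * q ≤ L) :
    N * q + dev (N * q) (tailExp N c e) + 4 * L * q ≤ 0.12 * (N * c) ∧ 23 * q ≤ c := by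
  have hN := h.N_pos
  have hq := h.q_pos
  have ha := h.sqrt_pos
  have hc := h.c_pos
  have h1 : 2.4 * q ≤ Real.sqrt (6 * q * L / N) := by
    refine Real.le_sqrt_of_sq_le ?_
    rw [le_div_iff₀ hN]
    have := mul_le_mul_of_nonneg_left hs hq.le
    nlinarith [mul_pos hq hN]
  have h2 : 23 * q ≤ c := by linarith [h.sep]
  refine ⟨?_, h2⟩
  have hb := Real.sq_sqrt h.min_pos.le
  have hb0 := Real.sqrt_nonneg (min c 0.5)
  have hab : Real.sqrt q * Real.sqrt (min c 0.5) ≤ 0.21 * c := by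
    refine abs_le_of_sq_le_sq' ?_ (by positivity) |>.2
    rw [mul_pow, h.sq_sqrt, hb]
    have : q * min c 0.5 ≤ c / 23 * c :=
      mul_le_mul (by linarith) (min_le_left _ _) h.min_pos.le (by positivity)
    nlinarith [sq_nonneg c]
  have he2 : e ^ 2 ≤ 1 / 16 := by nlinarith [h.e_pos, h.e_le]
  have h3 : min c 0.5 * e ^ 2 ≤ c * (1 / 16) :=
    mul_le_mul (min_le_left _ _) he2 (sq_nonneg _) hc.le
  have h4 : e * (Real.sqrt q * Real.sqrt (min c 0.5)) ≤ 1 / 4 * (0.21 * c) :=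
    mul_le_mul h.e_le hab (by positivity) (by norm_num)
  have h5 := h.dev_le_mul
  have h6 : L * q ≤ N * (c / 384) := by
    have := h.lq_le
    rw [div_le_iff₀ hN] at this
    linarith
  have h7 : 2 / 9 * min c 0.5 * e ^ 2 + 0.82 * e * Real.sqrt q * Real.sqrt (min c 0.5)
      ≤ 0.06 * c := by linarith
  have h8 := h5.trans (mul_le_mul_of_nonneg_left h7 hN.le)
  have h9 := mul_le_mul_of_nonneg_left h2 hN.le
  have h10 := mul_pos hN hc
  linarith

lemma gap_sub_of_small (h : Params N L q c e) (hs : N * q ≤ L) :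
    N * c * (1 - 2 * q) / 4 ≤ N * c * gap q e
      - 2 * (N * q + dev (N * q) (tailExp N c e) + 4 * L * q) := by
  obtain ⟨h1, h2⟩ := h.radius_le_of_small hs
  have hN := h.N_pos
  have hc := h.c_pos
  have ha := h.sqrt_pos
  have hq : q ≤ 1 / 23 := by linarith [h.c_le]
  have ha' : Real.sqrt q ≤ 0.21 := by
    refine Real.sqrt_le_iff.2 ⟨by norm_num, ?_⟩
    norm_num
    linarith
  have he2 : e ^ 2 ≤ 1 / 16 := by nlinarith [h.e_pos, h.e_le]
  have h4 : e * Real.sqrt q ≤ 1 / 4 * 0.21 := mul_le_mul h.e_le ha' ha.le (by norm_num)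
  have h5 : 0.24 + (1 - 2 * q) / 4 ≤ gap q e := by
    unfold gap
    linarith
  have h6 := mul_le_mul_of_nonneg_left h5 (mul_pos hN hc).le
  linarith

/-! ### Decay of the posteriors -/

/-- The bound for `q₀ (1 - q₀)`. -/
def noiseBound (N q : ℝ) : ℝ := q + 5 / 2 * (Real.sqrt (N * q) / N)

lemma sqrt_N_ge (h : Params N L q c e) : 30.3 ≤ Real.sqrt N := by
  refine Real.le_sqrt_of_sq_le ?_
  have := h.N_ge
  norm_num at this ⊢
  linarith

lemma noiseBound_eq (h : Params N L q c e) :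
    noiseBound N q = q + 5 / 2 * (Real.sqrt q / Real.sqrt N) := by
  have h1 : Real.sqrt (N * q) / N = Real.sqrt q / Real.sqrt N := by
    rw [Real.sqrt_mul h.N_pos.le, div_eq_div_iff h.N_pos.ne' (Real.sqrt_pos.2 h.N_pos).ne']
    rw [mul_right_comm, Real.mul_self_sqrt h.N_pos.le, mul_comm]
  unfold noiseBound
  rw [h1]

/-- `6L ≥ 102 ≥ 10²` turns the square root in `sep` into a multiple of `√(q/N)`. -/
lemma sep' (h : Params N L q c e) : 4 * q + 80 * (Real.sqrt q / Real.sqrt N) < c := by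
  have hN := h.N_pos
  have h1 : 10 * (Real.sqrt q / Real.sqrt N) ≤ Real.sqrt (6 * q * L / N) := by
    refine Real.le_sqrt_of_sq_le ?_
    rw [mul_pow, div_pow, h.sq_sqrt, Real.sq_sqrt hN.le, mul_div_assoc', div_le_div_iff_of_pos_right hN]
    nlinarith [h.q_pos, h.L_ge]
  linarith [h.sep]

/-- Keeps the odds `q₀/(1 - q₀)` away from 1. The value is `7/8` of `4q ≤ 6/7` plus at most `1/8`
from `sep'`. -/
lemma noiseBound_le (h : Params N L q c e) : 4 * noiseBound N q ≤ 7 / 8 := by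
  rw [h.noiseBound_eq]
  linarith [h.sep', h.c_le, h.q_le]

lemma noiseBound_le_mul (h : Params N L q c e) (hq : q ≤ 1 / 10) :
    4 * noiseBound N q ≤ 1.6 * Real.sqrt q := by
  have ha := h.sqrt_pos
  have h0 := h.sqrt_N_ge
  have h1 : Real.sqrt q / Real.sqrt N ≤ 0.0331 * Real.sqrt q := by
    rw [div_le_iff₀ (by linarith)]
    nlinarith
  have h2 : Real.sqrt q ≤ 0.3163 := by
    refine Real.sqrt_le_iff.2 ⟨by norm_num, ?_⟩
    norm_num
    linarith
  rw [h.noiseBound_eq]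
  have h3 : q ≤ 0.3163 * Real.sqrt q := by
    calc q = Real.sqrt q * Real.sqrt q := by rw [← sq, h.sq_sqrt]
      _ ≤ _ := by gcongr
  linarith

/-- The right-hand side is the base hidden in `constB`; this comparison brings `B` into the final
error. -/
lemma noiseBound_le_base (h : Params N L q c e) :
    4 * noiseBound N q ≤ (1 - q) * (4 * q + Real.sqrt q) := by
  have ha := h.sqrt_pos
  have ha' := h.sqrt_le
  have h0 := h.sqrt_N_ge
  have h1 : Real.sqrt q / Real.sqrt N ≤ 0.0331 * Real.sqrt q := by
    rw [div_le_iff₀ (by linarith)]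
    nlinarith
  rw [h.noiseBound_eq]
  have h3 := h.sq_sqrt
  have h4 : Real.sqrt q ^ 3 ≤ 0.463 ^ 2 * Real.sqrt q := by
    calc Real.sqrt q ^ 3 = Real.sqrt q ^ 2 * Real.sqrt q := by ring
      _ ≤ _ := by gcongr
  have h5 : q * q ≤ 0.463 ^ 3 * Real.sqrt q := by
    calc q * q = Real.sqrt q ^ 3 * Real.sqrt q := by nth_rw 1 2 [← h3]; ring
      _ ≤ _ := by gcongr
  have h6 : q * Real.sqrt q = Real.sqrt q ^ 3 := by nth_rw 1 [← h3]; ring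
  norm_num at h4 h5
  linarith

lemma ratio_le_noise {q₀ V : ℝ} (h0 : 0 ≤ q₀) (h1 : q₀ ≤ 1 / 2) (hV : q₀ * (1 - q₀) ≤ V) :
    q₀ / (1 - q₀) ≤ 4 * V := by
  refine le_trans ?_ (mul_le_mul_of_nonneg_left hV (by norm_num))
  rw [div_le_iff₀ (by linarith)]
  have h2 : 1 / 4 ≤ (1 - q₀) ^ 2 := by nlinarith
  nlinarith [mul_le_mul_of_nonneg_left h2 h0]

lemma rpow_le_exp {ρ y : ℝ} (h0 : 0 ≤ ρ) (hy : 0 ≤ y) : ρ ^ y ≤ Real.exp (-((1 - ρ) * y)) := by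
  calc ρ ^ y ≤ Real.exp (ρ - 1) ^ y := by
        have := Real.add_one_le_exp (ρ - 1)
        exact Real.rpow_le_rpow h0 (by linarith) hy
    _ = _ := by rw [← Real.exp_mul]; ring_nf

/-- Leakage in the first round. For `q ≤ 1/10` a few factors `ρ` supply powers of `q` and the rest
decays exponentially in `√(qN)`. For `q > 1/10`, `sep'` and `c ≤ 1` force `√N ≥ 42`, and decay
exponential in `√N` is enough. -/
lemma rpow_le_div (h : Params N L q c e) {ρ Δ : ℝ} (hρ : 0 ≤ ρ) (hρ' : ρ ≤ 4 * noiseBound N q)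
    (hΔ : q ≤ 1 / 10 → 1 / 7 * (N * c) ≤ Δ) (hΔ' : 1 / 16 * (N * c) ≤ Δ) : ρ ^ Δ ≤ q / N := by
  have hN := h.N_pos
  have hh := h.sqrt_N_ge
  have ha := h.sqrt_pos
  have hq := h.sq_sqrt
  have hNh := Real.sq_sqrt hN.le
  have hNc : N * (4 * q) + 80 * (Real.sqrt q * Real.sqrt N) ≤ N * c := by
    have h1 := mul_le_mul_of_nonneg_left h.sep'.le hN.le
    have h2 : N * (Real.sqrt q / Real.sqrt N) = Real.sqrt q * Real.sqrt N := by
      nth_rw 1 [← hNh]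
      field_simp
    linarith
  set a := Real.sqrt q with hadef
  set t := Real.sqrt N with ht
  have ht0 : 0 < t := by linarith
  rcases le_or_gt q (1 / 10) with hq1 | hq1
  · have h1 := h.noiseBound_le_mul hq1
    have hΔ1 := hΔ hq1
    have ha1 : a ≤ 0.3163 := by
      refine Real.sqrt_le_iff.2 ⟨by norm_num, ?_⟩
      norm_num
      linarith
    have hx : 0 < a * t := by positivity
    have hΔ64 : 64 ≤ Δ := by linarith [h.Nc_ge]
    have hΔx : 11 * (a * t) ≤ Δ := by nlinarith [mul_pos hN h.q_pos]
    have hρa : ρ ≤ 1.6 * a := hρ'.trans h1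
    -- Four factors give `6.6 q²`, since `1.6⁴ < 6.6`; the remaining power has to be at most `1/(6.6
    -- qN)`.
    rw [show Δ = 4 + (Δ - 4) by ring, Real.rpow_add_of_nonneg hρ (by norm_num) (by linarith)]
    have h2 : ρ ^ (4 : ℝ) ≤ 6.6 * q ^ 2 := by
      rw [show (4 : ℝ) = (4 : ℕ) by norm_num, Real.rpow_natCast]
      calc ρ ^ 4 ≤ (1.6 * a) ^ 4 := by gcongr
        _ = 1.6 ^ 4 * (a ^ 2) ^ 2 := by ring
        _ ≤ 6.6 * q ^ 2 := by
          rw [hq]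
          gcongr
          norm_num
    have h3 : ρ ^ (Δ - 4) ≤ 1 / (6.6 * q * N) := by
      calc ρ ^ (Δ - 4) ≤ Real.exp (-((1 - ρ) * (Δ - 4))) := rpow_le_exp hρ (by linarith)
        _ ≤ Real.exp (-(5 * (a * t))) := by
          rw [Real.exp_le_exp]
          have : 0.49 * (0.93 * Δ) ≤ (1 - ρ) * (Δ - 4) :=
            mul_le_mul (by linarith) (by linarith) (by linarith) (by linarith)
          linarith
        _ ≤ 1 / (6.6 * q * N) := by
          rw [Real.exp_neg, inv_eq_one_div]
          have hexp := Real.quadratic_le_exp_of_nonneg (x := 5 * (a * t)) (by positivity)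
          have e1 : (a * t) ^ 2 = q * N := by rw [mul_pow, hq, hNh]
          have : 6.6 * q * N ≤ Real.exp (5 * (a * t)) := by nlinarith
          have := h.q_pos
          gcongr
    calc ρ ^ (4 : ℝ) * ρ ^ (Δ - 4) ≤ 6.6 * q ^ 2 * (1 / (6.6 * q * N)) := by gcongr
      _ = q / N := by
        have := h.q_pos
        field_simp
  · have ha1 : 0.316 ≤ a := by
      refine Real.le_sqrt_of_sq_le ?_
      norm_num
      linarith
    have ht1 : 42 ≤ t := by
      have h1 : 80 * (a / t) ≤ 0.6 := by linarith [h.sep', h.c_le]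
      rw [mul_div_assoc', div_le_iff₀ ht0] at h1
      linarith
    have hΔt : 2.6 * t ≤ Δ := by
      have h1 : 42 * t ≤ N := by nlinarith
      have h2 : 0.316 * t ≤ a * t := by gcongr
      have h3 : N * 0.4 ≤ N * (4 * q) := by gcongr; linarith
      linarith
    have hρ1 : ρ ≤ 7 / 8 := hρ'.trans h.noiseBound_le
    calc ρ ^ Δ ≤ Real.exp (-((1 - ρ) * Δ)) := rpow_le_exp hρ (by linarith)
      _ ≤ Real.exp (-(0.325 * t)) := by
        rw [Real.exp_le_exp]
        have : 1 / 8 * (2.6 * t) ≤ (1 - ρ) * Δ :=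
          mul_le_mul (by linarith) hΔt (by linarith) (by linarith)
        linarith
      _ ≤ 1 / (10 * N) := by
        rw [Real.exp_neg, inv_eq_one_div]
        -- The eighth Taylor term suffices: six of its powers of `t ≥ 42` outweigh the constants,
        -- the other two give `N`.
        have hexp := Real.pow_div_factorial_le_exp (x := 0.325 * t) (by positivity) 8
        have h6 : 42 ^ 6 ≤ t ^ 6 := by gcongr
        have : 10 * N ≤ Real.exp (0.325 * t) := by
          refine le_trans ?_ hexp
          rw [le_div_iff₀ (by positivity), ← hNh]
          have e1 : (0.325 * t) ^ 8 = 0.325 ^ 8 * t ^ 6 * t ^ 2 := by ring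
          have e2 : 10 * t ^ 2 * ((8 : ℕ).factorial : ℝ) = 403200 * t ^ 2 := by
            norm_num [Nat.factorial]
            ring
          rw [e1, e2]
          gcongr
          norm_num at h6 ⊢
          linarith
        gcongr
      _ ≤ q / N := by
        rw [div_le_div_iff₀ (by positivity) hN]
        nlinarith

/-- The exponent is split into two halves: one gives the power that equals `exp(-ncB/4)`, the other
has exponent at least 32 and gives the factor `0.8 q`. -/
lemma rpow_le_mul_rpow (h : Params N L q c e) {ρ Δ : ℝ} (hρ : 0 ≤ ρ)
    (hρ' : ρ ≤ 4 * noiseBound N q) (hΔ : N * c * (1 - 2 * q) / 4 ≤ Δ) :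
    ρ ^ Δ ≤ 0.8 * q * ((1 - q) * (4 * q + Real.sqrt q)) ^ (N * c * (1 - 2 * q) / 8) := by
  have hNc := h.Nc_ge
  have hq := h.q_pos
  have hq2 := h.q_le
  have h1 : ρ ≤ 7 / 8 := hρ'.trans h.noiseBound_le
  set y := N * c * (1 - 2 * q) / 8 with hy
  have hy32 : 32 ≤ y := by rw [hy]; nlinarith
  have h2 : ρ ^ Δ ≤ ρ ^ (y + y) :=
    Real.rpow_le_rpow_of_exponent_ge' hρ (by linarith) (by linarith) (by linarith)
  refine h2.trans ?_
  rw [Real.rpow_add_of_nonneg hρ (by linarith) (by linarith)]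
  have h3 : ρ ^ y ≤ ((1 - q) * (4 * q + Real.sqrt q)) ^ y :=
    Real.rpow_le_rpow hρ (hρ'.trans h.noiseBound_le_base) (by linarith)
  have h4 : ρ ^ y ≤ 0.8 * q := by
    calc ρ ^ y ≤ ρ ^ ((32 : ℕ) : ℝ) :=
          Real.rpow_le_rpow_of_exponent_ge' hρ (by linarith) (by positivity) (by exact_mod_cast hy32)
      _ = ρ ^ 32 := Real.rpow_natCast _ _
      _ ≤ 0.8 * q := by
        rcases le_or_gt q (1 / 10) with hq1 | hq1
        · have ha := h.sqrt_pos
          have h5 : ρ ≤ 1.6 * Real.sqrt q := hρ'.trans (h.noiseBound_le_mul hq1)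
          calc ρ ^ 32 = ρ ^ 30 * ρ ^ 2 := by ring
            _ ≤ (7 / 8) ^ 30 * (1.6 * Real.sqrt q) ^ 2 := by gcongr
            _ = (7 / 8) ^ 30 * 1.6 ^ 2 * q := by rw [mul_pow, h.sq_sqrt]; ring
            _ ≤ 0.8 * q := by
              gcongr
              norm_num
        · calc ρ ^ 32 ≤ (7 / 8) ^ 32 := by gcongr
            _ ≤ 0.8 * (1 / 10) := by norm_num
            _ ≤ 0.8 * q := by gcongr
  exact mul_le_mul h4 h3 (Real.rpow_nonneg hρ _) (by positivity)

end Params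

lemma exp_constB {q : ℝ} (h0 : 0 < q) (h1 : q < 1) (y : ℝ) :
    Real.exp (-(y * constB q / 4)) =
      ((1 - q) * (4 * q + Real.sqrt q)) ^ (y * (1 - 2 * q) / 8) := by
  have hpos : 0 < (1 - q) * (4 * q + Real.sqrt q) :=
    mul_pos (by linarith) (by positivity)
  rw [Real.rpow_def_of_pos hpos]
  unfold constB
  rw [one_div ((1 - q) * _), Real.log_inv, Real.exp_eq_exp]
  ring

/-! ### Regular outcomes -/

section

variable {n m k l : ℕ}

/-- Pigeonhole: more than `k` initial templates are close to their centres, so two of them share a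
centre and are at most twice that radius apart. -/
lemma minInitDist_le_noiseBound {ω : Outcome n m k l} {P : Fin k → Binary n} {q : ℝ}
    (hn : 0 < n) (hinit : ¬ l ≤ k + (Finset.univ.filter fun a =>
      n * q + 5 / 2 * Real.sqrt (n * q) <
        D (T0 ω a) (toReal (P (ω.label (ω.init a))))).card) :
    1 / (2 * (n : ℝ)) * minInitDist ω ≤ Params.noiseBound n q := by
  classical
  set τ : ℝ := n * q + 5 / 2 * Real.sqrt (n * q) with hτ
  set good := Finset.univ.filter fun a =>
    ¬ τ < D (T0 ω a) (toReal (P (ω.label (ω.init a)))) with hgood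
  have hcard := Finset.card_filter_add_card_filter_not (s := (Finset.univ : Finset (Fin l)))
    (fun a => τ < D (T0 ω a) (toReal (P (ω.label (ω.init a)))))
  rw [Finset.card_univ, Fintype.card_fin] at hcard
  have hlt : (Finset.univ : Finset (Fin k)).card < good.card := by
    rw [Finset.card_univ, Fintype.card_fin, hgood]
    omega
  obtain ⟨a, ha, b, hb, hab, heq⟩ := Finset.exists_ne_map_eq_of_card_lt_of_maps_to hlt
    (f := fun a => ω.label (ω.init a)) (fun _ _ => Finset.mem_univ _)
  have ha' : D (T0 ω a) (toReal (P (ω.label (ω.init a)))) ≤ τ := by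
    simpa [hgood] using ha
  have hb' : D (T0 ω b) (toReal (P (ω.label (ω.init b)))) ≤ τ := by
    simpa [hgood] using hb
  rw [← heq, D_comm] at hb'
  have h1 := minInitDist_le ω hab
  have h2 := D_triangle (T0 ω a) (toReal (P (ω.label (ω.init a)))) (T0 ω b)
  have hn' : (0 : ℝ) < n := by exact_mod_cast hn
  calc 1 / (2 * (n : ℝ)) * minInitDist ω ≤ 1 / (2 * (n : ℝ)) * (2 * τ) := by
        gcongr
        linarith
    _ = Params.noiseBound n q := by
        rw [hτ]
        unfold Params.noiseBound
        field_simp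

/-- A foreign example contributes at most `(q/n) · n = q`; all `m` of these together cost at most
`4lq ∑ p`, because `∑ p ≥ m/(4l)`. -/
lemma mean_le_of_near {ω : Outcome n m k l} {P : Fin k → Binary n} {q r₀ : ℝ}
    (hn : 0 < n) (hl : 0 < l) (hq : 0 ≤ q)
    (hnear : ∀ j, D (toReal (ω.ex j)) (toReal (P (ω.label j))) ≤ r₀) (i : Fin k)
    (p : Fin m → ℝ) (hp0 : ∀ j, 0 ≤ p j) (hp : ∀ j, ω.label j ≠ i → p j ≤ q / n)
    (hW : m / (4 * (l : ℝ)) ≤ ∑ j, p j) :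
    ∑ j, p j * D (toReal (ω.ex j)) (toReal (P i)) ≤ (r₀ + 4 * l * q) * ∑ j, p j := by
  have hn' : (0 : ℝ) < n := by exact_mod_cast hn
  have hl' : (0 : ℝ) < l := by exact_mod_cast hl
  have key : ∀ j, p j * D (toReal (ω.ex j)) (toReal (P i)) ≤ r₀ * p j + q := by
    intro j
    by_cases hj : ω.label j = i
    · have h1 := mul_le_mul_of_nonneg_left (hnear j) (hp0 j)
      rw [hj] at h1
      linarith
    · have h1 : p j * D (toReal (ω.ex j)) (toReal (P i)) ≤ q / n * n :=
        mul_le_mul (hp j hj) (D_toReal_le _ _) (D_nonneg _ _) (by positivity)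
      rw [div_mul_cancel₀ _ hn'.ne'] at h1
      have h2 := mul_nonneg ((D_nonneg _ _).trans (hnear j)) (hp0 j)
      linarith
  have h1 := Finset.sum_le_sum fun j (_ : j ∈ Finset.univ) => key j
  rw [Finset.sum_add_distrib, ← Finset.mul_sum, Finset.sum_const, Finset.card_univ,
    Fintype.card_fin, nsmul_eq_mul] at h1
  rw [div_le_iff₀ (by positivity)] at hW
  have h2 := mul_le_mul_of_nonneg_right hW hq
  linarith

/-- Up to `nq + y` a distance is charged to its own posterior. The excesses and the foreign examples
together cost at most `(y/2 + y/2) ∑ p`, since `∑ p ≥ m/(4l)`. -/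
lemma mean_le_of_excess {ω : Outcome n m k l} {P : Fin k → Binary n} {q y : ℝ}
    (hn : 0 < n) (hl : 0 < l) (hq : 0 ≤ q) (hy : 8 * l * q ≤ y)
    (hex : ∑ j, max (D (toReal (ω.ex j)) (toReal (P (ω.label j))) - n * q - y) 0 ≤
      m / (4 * (l : ℝ)) * (y / 2)) (i : Fin k)
    (p : Fin m → ℝ) (hp0 : ∀ j, 0 ≤ p j) (hp1 : ∀ j, p j ≤ 1)
    (hp : ∀ j, ω.label j ≠ i → p j ≤ q / n) (hW : m / (4 * (l : ℝ)) ≤ ∑ j, p j) :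
    ∑ j, p j * D (toReal (ω.ex j)) (toReal (P i)) ≤ (n * q + 2 * y) * ∑ j, p j := by
  have hn' : (0 : ℝ) < n := by exact_mod_cast hn
  have hl' : (0 : ℝ) < l := by exact_mod_cast hl
  have hy0 : 0 ≤ y := le_trans (by positivity) hy
  have key : ∀ j, p j * D (toReal (ω.ex j)) (toReal (P i)) ≤ (n * q + y) * p j +
      max (D (toReal (ω.ex j)) (toReal (P (ω.label j))) - n * q - y) 0 + q := by
    intro j
    have hmax := le_max_right (D (toReal (ω.ex j)) (toReal (P (ω.label j))) - n * q - y) 0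
    by_cases hj : ω.label j = i
    · have h1 := mul_le_mul_of_nonneg_left
        (le_max_left (D (toReal (ω.ex j)) (toReal (P (ω.label j))) - n * q - y) 0) (hp0 j)
      have h2 := mul_le_of_le_one_left hmax (hp1 j)
      rw [hj] at h1 h2 ⊢
      linarith
    · have h1 : p j * D (toReal (ω.ex j)) (toReal (P i)) ≤ q / n * n :=
        mul_le_mul (hp j hj) (D_toReal_le _ _) (D_nonneg _ _) (by positivity)
      rw [div_mul_cancel₀ _ hn'.ne'] at h1
      have h2 : 0 ≤ (n * q + y) * p j := mul_nonneg (by positivity) (hp0 j)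
      linarith
  have h1 := Finset.sum_le_sum fun j (_ : j ∈ Finset.univ) => key j
  rw [Finset.sum_add_distrib, Finset.sum_add_distrib, ← Finset.mul_sum, Finset.sum_const,
    Finset.card_univ, Fintype.card_fin, nsmul_eq_mul] at h1
  have h3 := mul_le_mul_of_nonneg_right hW (show 0 ≤ y / 2 by linarith)
  rw [div_le_iff₀ (by positivity)] at hW
  have h2 := mul_le_mul_of_nonneg_right hW hq
  have h4 : (∑ j, p j) * (8 * l * q) ≤ (∑ j, p j) * y :=
    mul_le_mul_of_nonneg_left hy (Finset.sum_nonneg fun j _ => hp0 j)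
  linarith

/-- Deterministic part of the theorem. -/
theorem success_of_regular {ω : Outcome n m k l} {P : Fin k → Binary n} {w : Fin k → ℝ}
    {wmin q c e : ℝ} (h : Params n l q c e) (hm : 0 < m) (hk : 0 < k) (hkl : k ≤ l)
    (hwmin : 0 < wmin) (hw : ∀ i, wmin ≤ w i) (hkw : k * wmin ≤ 1)
    (hP : ∀ i i', i ≠ i' → n * c ≤ D (toReal (P i)) (toReal (P i')))
    (hS : ∀ i, m * w i / 2 ≤ (S ω i).card)
    (hC : ∀ i, ((Finset.univ.filter fun a => ω.label (ω.init a) = i).card : ℝ) ≤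
      3 / 2 * l * w i)
    (hC' : ∀ i, ∃ a, ω.label (ω.init a) = i)
    (hinit : ¬ l ≤ k + (Finset.univ.filter fun a => n * q + 5 / 2 * Real.sqrt (n * q) <
      D (T0 ω a) (toReal (P (ω.label (ω.init a))))).card)
    (hnear : ∀ j, D (toReal (ω.ex j)) (toReal (P (ω.label j))) ≤
      n * q + dev (n * q) (tailExp n c e))
    (hsep : ∀ j i, i ≠ ω.label j → D (toReal (ω.ex j)) (toReal (P (ω.label j))) +
        (D (toReal (P (ω.label j))) (toReal (P i)) * (1 - 2 * q)
          - 2 * dev (D (toReal (P (ω.label j))) (toReal (P i)) * q) (tailExp n c e)) ≤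
      D (toReal (ω.ex j)) (toReal (P i)))
    (hex : (l : ℝ) ≤ n * q → ∑ j, max (D (toReal (ω.ex j)) (toReal (P (ω.label j))) - n * q
        - Real.sqrt (6 * l * (n * q))) 0 ≤
      m / (4 * (l : ℝ)) * (Real.sqrt (6 * l * (n * q)) / 2)) :
    Success P (5 / wmin * Real.exp (-(n * c * constB q / 4)) * (n * q)) ω := by
  have hN : (0 : ℝ) < n := h.N_pos
  have hn : 0 < n := by exact_mod_cast hN
  have hL : (0 : ℝ) < l := h.L_pos
  have hl : 0 < l := by exact_mod_cast hL
  have hq := h.q_pos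
  have hq' := h.q_le
  have hlq : l * q / n ≤ 1 / 384 := h.lq_le.trans (by linarith [h.c_le])
  obtain ⟨r, h4r, hgap, hmean⟩ : ∃ r : ℝ, 4 * r < n * c ∧
      n * c * (1 - 2 * q) / 4 ≤ n * c * gap q e - 2 * r ∧
      ∀ i (p : Fin m → ℝ), (∀ j, 0 ≤ p j) → (∀ j, p j ≤ 1) →
        (∀ j, ω.label j ≠ i → p j ≤ q / n) → m / (4 * (l : ℝ)) ≤ ∑ j, p j →
        ∑ j, p j * D (toReal (ω.ex j)) (toReal (P i)) ≤ r * ∑ j, p j := by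
    rcases le_total (n * q) (l : ℝ) with hs | hs
    · refine ⟨_, ?_, h.gap_sub_of_small hs, fun i p hp0 _ hp hW =>
        mean_le_of_near hn hl hq.le hnear i p hp0 hp hW⟩
      have := (h.radius_le_of_small hs).1
      have := mul_pos hN h.c_pos
      linarith
    · refine ⟨_, h.four_radius_lt_of_large, h.gap_sub_of_large, fun i p hp0 hp1 hp hW =>
        mean_le_of_excess hn hl hq.le ?_ (hex hs) i p hp0 hp1 hp hW⟩
      refine Real.le_sqrt_of_sq_le ?_
      rw [div_le_iff₀ hN] at hlq
      have h1 : l * q * (64 * (l * q)) ≤ l * q * (6 * n) :=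
        mul_le_mul_of_nonneg_left (by linarith) (by positivity)
      linarith
  have hκ : ∀ {Δ : ℝ}, n * c * (1 - 2 * q) / 4 ≤ Δ → 1 / 7 * (n * c) ≤ Δ := by
    intro Δ hΔ
    refine le_trans ?_ hΔ
    have : n * c * q ≤ n * c * (3 / 14) := by
      have := h.c_pos
      gcongr
    linarith
  have hNc : 0 < n * c := mul_pos hN h.c_pos
  have hQ : 0 < (1 - q) * (4 * q + Real.sqrt q) :=
    mul_pos (by linarith) (by have := h.sqrt_pos; positivity)
  set R := ((1 - q) * (4 * q + Real.sqrt q)) ^ (n * c * (1 - 2 * q) / 8) with hR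
  have hR0 : 0 < R := Real.rpow_pos_of_pos hQ _
  have hρ : ∀ q₀ : ℝ, 0 ≤ q₀ → q₀ ≤ 1 / 2 → q₀ * (1 - q₀) ≤ Params.noiseBound n q →
      0 ≤ q₀ / (1 - q₀) ∧ q₀ / (1 - q₀) ≤ 4 * Params.noiseBound n q := fun q₀ h0 h1 h2 =>
    ⟨div_nonneg h0 (by linarith), Params.ratio_le_noise h0 h1 h2⟩
  have hΔ₁ := h.le_gap_sub (κ := 1 / 16) (by norm_num) (fun h => absurd h (lt_irrefl _))
  have hlq' : (l : ℝ) * (q / n) ≤ 1 / 384 := by rwa [mul_div_assoc']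
  -- In `lam₂` the first entry keeps the lost mass below `1/2` and the second carries the final
  -- error, where `6 · 0.8 ≤ 5`.
  refine success_of_good (V := Params.noiseBound n q)
    (r₀ := n * q + dev (n * q) (tailExp n c e)) (r := r) (ζ := n * c * gap q e) (δ := n * c)
    (lam₁ := q / n) (lam₂ := min (q / n) (0.8 * q * R)) hm hl hk hwmin hw hkw hS hC hC'
    (minInitDist_le_noiseBound hn hinit) (by linarith [h.noiseBound_le]) hnear ?_ hP hmean h4r
    (by linarith) (by linarith [hκ hgap]) ?_ ?_ (by linarith) (by positivity)
    (le_min (by positivity) (by positivity)) ?_ ?_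
  · intro j i hij
    have h1 := hsep j i hij
    have h2 := h.mul_gap_le (hP _ _ hij.symm)
    linarith
  · intro q₀ h0 h1 h2
    obtain ⟨h3, h4⟩ := hρ q₀ h0 h1 h2
    exact h.rpow_le_div h3 h4
      (fun h5 => h.le_gap_sub (κ := 1 / 7) le_rfl fun _ => h5) hΔ₁
  · intro q₀ h0 h1 h2
    obtain ⟨h3, h4⟩ := hρ q₀ h0 h1 h2
    refine le_min (h.rpow_le_div h3 h4 (fun _ => hκ hgap) ?_) (h.rpow_le_mul_rpow h3 h4 hgap)
    linarith [hκ hgap]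
  · calc (k : ℝ) * min (q / n) (0.8 * q * R) ≤ l * (q / n) := by
          gcongr
          exact min_le_left _ _
      _ ≤ 1 / 2 := by linarith
  · rw [exp_constB hq (by linarith) (n * c), ← hR]
    calc 6 / wmin * min (q / n) (0.8 * q * R) * n ≤ 6 / wmin * (0.8 * q * R) * n := by
          gcongr
          exact min_le_right _ _
      _ = 4.8 / wmin * R * (n * q) := by ring
      _ ≤ 5 / wmin * R * (n * q) := by
          gcongr
          norm_num

end

/-! ### Probability of the regular outcomes -/

/-- `137 = 8 · 17 + 1` is the least `m` compatible with `8l < m` and `l ≥ 17`, and `137² > e^9.6`.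
-/
lemma tailExp_ge {m : ℕ} {A : ℝ} (hm : 137 ≤ m) (h : (m : ℝ) ^ 2 * Real.exp (-A) < 1) :
    9.6 ≤ A := by
  have hm' : (137 : ℝ) ≤ m := by exact_mod_cast hm
  by_contra! hA
  have h1 : Real.exp A ≤ 18769 := by
    refine (Real.exp_le_exp.2 hA.le).trans ?_
    refine le_of_pow_le_pow_left₀ (n := 5) (by norm_num) (by norm_num) ?_
    calc Real.exp 9.6 ^ 5 = Real.exp 1 ^ 48 := by
          rw [← Real.exp_nat_mul, ← Real.exp_nat_mul]
          norm_num
      _ ≤ 2.7183 ^ 48 := by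
          have := Real.exp_one_lt_d9
          gcongr
          linarith
      _ ≤ 18769 ^ 5 := by norm_num
  have h2 : (18769 : ℝ) ≤ (m : ℝ) ^ 2 := by nlinarith
  rw [Real.exp_neg, ← div_eq_mul_inv, div_lt_one (Real.exp_pos _)] at h
  linarith

/-- Because `k ≥ 2`, the assumption gives `l · wmin > 12 log 2 > 8.3`; multiply by `k` and use `k ·
wmin ≤ 1`. -/
lemma eight_mul_le {k l : ℕ} {wmin : ℝ} (hk : 2 ≤ k) (hkw : k * wmin ≤ 1)
    (h : k * Real.exp (-(l * wmin / 12)) < 1) : 8 * k < l := by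
  have hk' : (2 : ℝ) ≤ k := by exact_mod_cast hk
  rw [Real.exp_neg, ← div_eq_mul_inv, div_lt_one (Real.exp_pos _)] at h
  have h1 : Real.log 2 < l * wmin / 12 := by
    rw [Real.log_lt_iff_lt_exp (by norm_num)]
    linarith
  have h2 := Real.log_two_gt_d9
  have h3 : 8.3 < l * wmin := by linarith
  have h4 : (l : ℝ) * (k * wmin) ≤ l * 1 := by gcongr
  have h5 : (k : ℝ) * 8.3 ≤ k * (l * wmin) := by gcongr
  have : (8 : ℝ) * k < l := by linarith
  exact_mod_cast this

lemma separation {n k : ℕ} {P : Fin k → Binary n} {c : ℝ} (hc : IsSeparated P c) :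
    c ≤ 1 ∧ 2 ≤ k ∧ ∀ i i', i ≠ i' → n * c ≤ D (toReal (P i)) (toReal (P i')) := by
  obtain ⟨⟨i, i', hii', rfl⟩, hmin⟩ := hc
  refine ⟨div_le_one_of_le₀ (D_toReal_le _ _) (Nat.cast_nonneg _), ?_, fun a b hab => ?_⟩
  · have h1 := i.isLt
    have h2 := i'.isLt
    have h3 : i.val ≠ i'.val := fun h => hii' (Fin.ext h)
    omega
  · have h := hmin ⟨a, b, hab, rfl⟩
    rcases Nat.eq_zero_or_pos n with hn | hn
    · subst hn
      simpa using D_nonneg _ _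
    · have hn' : (0 : ℝ) < n := by exact_mod_cast hn
      calc n * (D (toReal (P i)) (toReal (P i')) / n)
          ≤ n * (D (toReal (P a)) (toReal (P b)) / n) := by gcongr
        _ = _ := mul_div_cancel₀ _ hn'.ne'

/-- The second entry of the maximum, with `c ≤ 1`, gives `8q ≤ 3(1 - 2q)`, that is `q ≤ 3/14`. From
`e ≤ 1/4` and `tailExp ≥ 9.6` follows `n · min c 0.5 ≥ 48 · 9.6 > 460`. -/
lemma params_of_hypotheses {n l : ℕ} {q c e : ℝ} (hq : 0 < q) (hq' : q < 1 / 2) (hc : c ≤ 1)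
    (he : 0 < e) (heE : e ≤ constE n l q c)
    (hsep : c > max 1 (2 / (3 * (1 - 2 * q))) * (4 * q + 8 * Real.sqrt (6 * q * l / n)))
    (hl : 17 ≤ l) (hA : 9.6 ≤ tailExp n c e) : Params n l q c e := by
  have hs0 := Real.sqrt_nonneg (6 * q * l / n)
  have hX : 0 < 4 * q + 8 * Real.sqrt (6 * q * l / n) := by positivity
  have h12 : 0 < 1 - 2 * q := by linarith
  have h1 : 4 * q + 8 * Real.sqrt (6 * q * l / n) < c := by
    refine lt_of_le_of_lt ?_ hsep
    exact le_mul_of_one_le_left hX.le (le_max_left _ _)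
  have h2 : 2 / (3 * (1 - 2 * q)) * (4 * q + 8 * Real.sqrt (6 * q * l / n)) < c :=
    lt_of_le_of_lt (mul_le_mul_of_nonneg_right (le_max_right _ _) hX.le) hsep
  rw [div_mul_eq_mul_div, div_lt_iff₀ (by positivity)] at h2
  have hc0 : 0 < c := by linarith
  have hq2 : q ≤ 3 / 14 := by
    have := mul_le_mul_of_nonneg_right hc (show 0 ≤ 3 * (1 - 2 * q) by positivity)
    linarith
  unfold constE at heE
  have he1 : e ≤ 1 / 4 := heE.trans (min_le_left _ _)
  have he2 := (heE.trans (min_le_right _ _)).trans (min_le_right _ _)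
  have hden : 0 < c * (1 - 2 * q) + q + Real.sqrt q := by positivity
  rw [le_div_iff₀ hden] at he2
  have hNc : 460 ≤ n * min c 0.5 := by
    unfold tailExp at hA
    have h3 : 0 ≤ (n : ℝ) * min c 0.5 :=
      mul_nonneg (Nat.cast_nonneg _) (le_min hc0.le (by norm_num))
    have h4 : e ^ 2 ≤ 1 / 16 := by nlinarith
    have h5 := mul_le_mul_of_nonneg_left h4 h3
    linarith
  have hn0 : (0 : ℝ) ≤ n := Nat.cast_nonneg n
  refine ⟨hq, hq2, hc, he, he1, by exact_mod_cast hl, ?_, ?_, h1, by linarith⟩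
  · have := mul_le_mul_of_nonneg_left (min_le_right c 0.5) hn0
    linarith
  · have := mul_le_mul_of_nonneg_left (min_le_left c 0.5) hn0
    linarith

lemma exp_le_one_div {m n : ℕ} (hn : 0 < n) (h : 16 * Real.log n < m) :
    Real.exp (-(m / 16)) ≤ 1 / n := by
  have hn' : (0 : ℝ) < n := by exact_mod_cast hn
  rw [one_div, ← Real.exp_log hn', ← Real.exp_neg, Real.exp_le_exp]
  linarith

lemma prob_empty {n m k l : ℕ} (P : Fin k → Binary n) (w : Fin k → ℝ) (q : ℝ) :
    prob P w q (∅ : Set (Outcome n m k l)) = 0 := by simp [prob]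

theorem prob_not_success_le {n m k l : ℕ} {P : Fin k → Binary n} {w : Fin k → ℝ}
    {wmin q c e : ℝ} (h : Params n l q c e) (hk : 2 ≤ k) (hkl : 8 * k < l) (hlm : 8 * l < m)
    (hmn : 16 * Real.log n < m) (hw1 : ∑ i, w i = 1) (hwmin : 0 < wmin)
    (hw : ∀ i, wmin ≤ w i) (hkw : k * wmin ≤ 1)
    (hP : ∀ i i', i ≠ i' → n * c ≤ D (toReal (P i)) (toReal (P i'))) :
    prob (m := m) (l := l) P w q
        {ω | Success P (5 / wmin * Real.exp (-(n * c * constB q / 4)) * (n * q)) ω}ᶜ ≤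
      (m : ℝ) ^ 2 * Real.exp (-tailExp n c e) + k * Real.exp (-(m * wmin / 8))
        + k * (l + 1) * Real.exp (-(l * wmin)) + k * Real.exp (-(l * wmin / 12)) + k / n := by
  classical
  have hw0 : ∀ i, 0 ≤ w i := fun i => hwmin.le.trans (hw i)
  have hq0 := h.q_pos
  have hq1 : q ≤ 1 := by linarith [h.q_le]
  have hlm' : l ≤ m := by omega
  have hN : (0 : ℝ) < n := h.N_pos
  have hn : 0 < n := by exact_mod_cast hN
  have hA := h.tailExp_pos
  have hl17 : 17 ≤ l := by omega
  have hk2 : (2 : ℝ) ≤ k := by exact_mod_cast hk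
  set A := tailExp n c e with hAdef
  have b1 := prob_exists_le (P := P) (q := q) (m := m) (l := l) hw0 hq0.le hq1
    (fun i => {ω : Outcome n m k l | ((S ω i).card : ℝ) < m * w i / 2})
    fun i => prob_card_S_lt_le hlm' hw0 hw1 hq0.le hq1 i
  have b2 := prob_exists_le (P := P) (q := q) (m := m) (l := l) hw0 hq0.le hq1
    (fun i => {ω : Outcome n m k l | ∀ a, ω.label (ω.init a) ≠ i})
    fun i => prob_no_init_le hlm' hw0 hw1 hq0.le hq1 i
  have b3 := prob_exists_le (P := P) (q := q) (m := m) (l := l) hw0 hq0.le hq1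
    (fun i => {ω : Outcome n m k l | 3 / 2 * l * w i <
      ((Finset.univ.filter fun a => ω.label (ω.init a) = i).card : ℝ)})
    fun i => prob_many_init_le hlm' hw0 hw1 hq0.le hq1 i
  have b4 := prob_bad_init_le (P := P) hlm' hw0 hw1 hq0 hq1 hn hkl.le
  have b5 := prob_far_from_template_le (P := P) hlm' hw0 hw1 hq0 hq1 hA hn
  have b6 := prob_not_separated_le hlm' hw0 hw1 hq0 hq1 hA
    fun i i' hii' => (mul_pos hN h.c_pos).trans_le (hP i i' hii')
  have b7 : prob P w q {ω : Outcome n m k l | (l : ℝ) ≤ n * q ∧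
      m / (4 * (l : ℝ)) * (Real.sqrt (6 * l * (n * q)) / 2) <
      ∑ j, max (D (toReal (ω.ex j)) (toReal (P (ω.label j))) - n * q
        - Real.sqrt (6 * l * (n * q))) 0} ≤ 1 / n := by
    by_cases hlnq : (l : ℝ) ≤ n * q
    · refine (prob_mono hw0 hq0.le hq1 fun ω hω => hω.2).trans
        ((prob_excess_le (P := P) hlm' hw0 hw1 hq0 hq1 hl17 hlnq).trans
          (exp_le_one_div hn hmn))
    · simp only [hlnq, false_and, Set.ofPred_false, prob_empty]
      positivity
  set B1 := {ω : Outcome n m k l | ∃ i, ω ∈ (fun i => {ω : Outcome n m k l |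
    ((S ω i).card : ℝ) < m * w i / 2}) i} with hB1
  set B2 := {ω : Outcome n m k l | ∃ i, ω ∈ (fun i => {ω : Outcome n m k l |
    ∀ a, ω.label (ω.init a) ≠ i}) i} with hB2
  set B3 := {ω : Outcome n m k l | ∃ i, ω ∈ (fun i => {ω : Outcome n m k l |
    3 / 2 * l * w i < ((Finset.univ.filter fun a => ω.label (ω.init a) = i).card : ℝ)}) i}
    with hB3
  set B4 := {ω : Outcome n m k l | l ≤ k + (Finset.univ.filter fun a =>
      n * q + 5 / 2 * Real.sqrt (n * q) <
        D (T0 ω a) (toReal (P (ω.label (ω.init a))))).card} with hB4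
  set B5 := {ω : Outcome n m k l | ∃ j, n * q + dev (n * q) A <
      D (toReal (ω.ex j)) (toReal (P (ω.label j)))} with hB5
  set B6 := {ω : Outcome n m k l | ∃ j, ∃ i, i ≠ ω.label j ∧
      D (toReal (ω.ex j)) (toReal (P i)) < D (toReal (ω.ex j)) (toReal (P (ω.label j))) +
        (D (toReal (P (ω.label j))) (toReal (P i)) * (1 - 2 * q)
          - 2 * dev (D (toReal (P (ω.label j))) (toReal (P i)) * q) A)} with hB6
  set B7 := {ω : Outcome n m k l | (l : ℝ) ≤ n * q ∧
      m / (4 * (l : ℝ)) * (Real.sqrt (6 * l * (n * q)) / 2) <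
      ∑ j, max (D (toReal (ω.ex j)) (toReal (P (ω.label j))) - n * q
        - Real.sqrt (6 * l * (n * q))) 0} with hB7
  have hsub : {ω : Outcome n m k l | Success P
      (5 / wmin * Real.exp (-(n * c * constB q / 4)) * (n * q)) ω}ᶜ ⊆
      B1 ∪ (B2 ∪ (B3 ∪ (B4 ∪ (B5 ∪ (B6 ∪ B7))))) := by
    intro ω hω
    by_contra hbad
    simp only [Set.mem_union, not_or] at hbad
    obtain ⟨h1, h2, h3, h4, h5, h6, h7⟩ := hbad
    simp only [hB1, hB2, hB3, hB4, hB5, hB6, hB7, Set.mem_ofPred_eq, not_exists, not_lt, not_forall,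
      not_not, not_and, not_le] at h1 h2 h3 h4 h5 h6 h7
    exact hω (success_of_regular h (by omega) (by omega) (by omega) hwmin hw hkw hP h1 h3 h2
      (not_le.2 h4) h5 h6 h7)
  have u := fun (X Y : Set (Outcome n m k l)) => prob_union_le (P := P) hw0 hq0.le hq1 X Y
  have hmain : prob P w q {ω : Outcome n m k l | Success P
      (5 / wmin * Real.exp (-(n * c * constB q / 4)) * (n * q)) ω}ᶜ ≤
      prob P w q B1 + (prob P w q B2 + (prob P w q B3 + (prob P w q B4 + (prob P w q B5 +
        (prob P w q B6 + prob P w q B7))))) := by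
    refine (prob_mono hw0 hq0.le hq1 hsub).trans ?_
    linarith [u B1 (B2 ∪ (B3 ∪ (B4 ∪ (B5 ∪ (B6 ∪ B7))))), u B2 (B3 ∪ (B4 ∪ (B5 ∪ (B6 ∪ B7)))),
      u B3 (B4 ∪ (B5 ∪ (B6 ∪ B7))), u B4 (B5 ∪ (B6 ∪ B7)), u B5 (B6 ∪ B7), u B6 B7]
  have hsum : ∀ (f : Fin k → ℝ) (b : ℝ), (∀ i, f i ≤ b) → ∑ i, f i ≤ k * b := by
    intro f b hf
    calc ∑ i, f i ≤ ∑ _i : Fin k, b := Finset.sum_le_sum fun i _ => hf i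
      _ = k * b := by simp
  have s1 := b1.trans (hsum _ (Real.exp (-(m * wmin / 8))) fun i => by gcongr; exact hw i)
  have s2 := b2.trans (hsum _ (Real.exp (-(l * wmin))) fun i => by gcongr; exact hw i)
  have s3 := b3.trans (hsum _ (Real.exp (-(l * wmin / 12))) fun i => by gcongr; exact hw i)
  -- As `k ≥ 2`, `wmin ≤ 1/2`, so `e^(-l/2)` fits into the part `k l` of the factor `k (l + 1)`; the
  -- remaining `k` pays for `B2`.
  have s4 : prob P w q B4 ≤ k * l * Real.exp (-(l * wmin)) := by
    have hle : Real.exp (-((l : ℝ) / 2)) ≤ Real.exp (-(l * wmin)) := by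
      rw [Real.exp_le_exp]
      have h1 : wmin ≤ 1 / 2 := by
        have := mul_le_mul_of_nonneg_right hk2 hwmin.le
        linarith
      have h2 := mul_le_mul_of_nonneg_left h1 (Nat.cast_nonneg (α := ℝ) l)
      linarith
    have h1 : (1 : ℝ) ≤ k * l := by
      have : (17 : ℝ) ≤ l := by exact_mod_cast hl17
      nlinarith
    exact (b4.trans hle).trans (le_mul_of_one_le_left (Real.exp_nonneg _) h1)
  -- One tail event per example for its own template and at most `k` for the others: `k + 1 ≤ m`
  -- merges them into `m²`.
  have s56 : (m : ℝ) * Real.exp (-A) + m * (k * Real.exp (-A)) ≤ m ^ 2 * Real.exp (-A) := by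
    have h1 : (k : ℝ) + 1 ≤ m := by
      have : k + 1 ≤ m := by omega
      exact_mod_cast this
    have h2 : (m : ℝ) * (k + 1) * Real.exp (-A) ≤ m * m * Real.exp (-A) := by gcongr
    linarith
  have s7 : (1 : ℝ) / n ≤ k / n := by
    gcongr
    linarith
  linarith

end

end TwoRoundEM

theorem theorem2 (n m k l : ℕ) (P : Fin k → TwoRoundEM.Binary n) (w : Fin k → ℝ)
    (wmin q c ε₀ : ℝ)
    (hq : 0 < q) (hq' : q < 1 / 2) (hB : 0 < TwoRoundEM.constB q)
    (hc : TwoRoundEM.IsSeparated P c)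
    (hw_sum : ∑ i, w i = 1) (hwmin : 0 < wmin) (hw : ∀ i, wmin ≤ w i)
    (hl : k < l)
    (hε : 0 < ε₀) (hεE : ε₀ ≤ TwoRoundEM.constE n l q c)
    (C1 : (n : ℝ) * c > 1 / (TwoRoundEM.constB q * (1 - 2 * q)) *
      Real.log (16 * l / min (6 * n * q) 1))
    (C2 : (m : ℝ) > max (16 * Real.log n) (8 * l))
    (C3 : c > max 1 (2 / (3 * (1 - 2 * q))) * (4 * q + 8 * Real.sqrt (6 * q * l / n))) :
    1 - (m : ℝ) ^ 2 * Real.exp (-(2 * n * (1 - q) * ε₀ ^ 2 / 3))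
      - (m : ℝ) ^ 2 * Real.exp (-(n * min c 0.5 * ε₀ ^ 2 / 3))
      - 2 * m * Real.exp (-(n * ε₀ ^ 2 / 3))
      - 2 * m * Real.exp (-(n * min c 0.5 * ε₀ ^ 2 / 3))
      - k * Real.exp (-(m * wmin / 8))
      - k * (l + 1) * Real.exp (-(l * wmin))
      - k * Real.exp (-(l * wmin / 12))
      - k / n
    ≤ TwoRoundEM.prob (m := m) (l := l) P w q
        {ω | TwoRoundEM.Success P
          (5 / wmin * Real.exp (-(n * c * TwoRoundEM.constB q / 4)) * (n * q)) ω} := by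
  open TwoRoundEM in
  have hw0 : ∀ i, 0 ≤ w i := fun i => hwmin.le.trans (hw i)
  have p1 : 0 ≤ (m : ℝ) ^ 2 * Real.exp (-(2 * n * (1 - q) * ε₀ ^ 2 / 3)) := by positivity
  have p2 : 0 ≤ (m : ℝ) ^ 2 * Real.exp (-(n * min c 0.5 * ε₀ ^ 2 / 3)) := by positivity
  have p3 : 0 ≤ 2 * (m : ℝ) * Real.exp (-(n * ε₀ ^ 2 / 3)) := by positivity
  have p4 : 0 ≤ 2 * (m : ℝ) * Real.exp (-(n * min c 0.5 * ε₀ ^ 2 / 3)) := by positivity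
  have p5 : 0 ≤ (k : ℝ) * Real.exp (-(m * wmin / 8)) := by positivity
  have p6 : 0 ≤ (k : ℝ) * (l + 1) * Real.exp (-(l * wmin)) := by positivity
  have p7 : 0 ≤ (k : ℝ) * Real.exp (-(l * wmin / 12)) := by positivity
  have p8 : 0 ≤ (k : ℝ) / n := by positivity
  -- If one of these two error terms is at least 1, the claimed lower bound is not positive.
  -- Otherwise they yield the size conditions behind `Params`.
  by_cases h1 : (m : ℝ) ^ 2 * Real.exp (-(n * min c 0.5 * ε₀ ^ 2 / 3)) < 1
  swap
  · have := prob_nonneg (P := P) hw0 hq.le (by linarith) {ω : Outcome n m k l | Success P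
      (5 / wmin * Real.exp (-(n * c * constB q / 4)) * (n * q)) ω}
    linarith
  by_cases h2 : (k : ℝ) * Real.exp (-(l * wmin / 12)) < 1
  swap
  · have := prob_nonneg (P := P) hw0 hq.le (by linarith) {ω : Outcome n m k l | Success P
      (5 / wmin * Real.exp (-(n * c * constB q / 4)) * (n * q)) ω}
    linarith
  obtain ⟨hc1, hk, hP⟩ := separation hc
  have hkw : k * wmin ≤ 1 := by
    calc k * wmin = ∑ _i : Fin k, wmin := by simp
      _ ≤ ∑ i, w i := Finset.sum_le_sum fun i _ => hw i
      _ = 1 := hw_sum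
  have hkl := eight_mul_le hk hkw h2
  have hlm : 8 * l < m := by
    have : (8 : ℝ) * l < m := lt_of_le_of_lt (le_max_right _ _) C2
    exact_mod_cast this
  have hmn : 16 * Real.log n < m := lt_of_le_of_lt (le_max_left _ _) C2
  have hA : 9.6 ≤ tailExp n c ε₀ := tailExp_ge (by omega) h1
  have hpar := params_of_hypotheses hq hq' hc1 hε hεE C3 (by omega) hA
  have hmain := prob_not_success_le hpar hk hkl hlm hmn hw_sum hwmin hw hkw hP
  have htot := one_le_prob_add_prob_compl (P := P) (q := q) (show l ≤ m by omega) hw_sum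
    {ω : Outcome n m k l | Success P
      (5 / wmin * Real.exp (-(n * c * constB q / 4)) * (n * q)) ω}
  unfold tailExp at hmain
  linarith
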